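/- Work on the infinite triangular lattice, in which every site has six neighbours. A configuration of $n$ (anonymous) agents is a set $\sigma$ of $n$ occupied sites; it is connected if it induces a connected subgraph of the lattice, and simply connected if it is connected and has no hole, i.e. every connected component of the set of unoccupied sites is infinite. For a site $\ell$ let $N(\ell)$ be the set of agents at sites adjacent to $\ell$. Moving an agent from its site $\ell$ to an adjacent unoccupied site $\ell'$ is a valid compression move if $|N(\ell)|<5$ and one of the following holds, where $N(\ell\cup\ell') = (N(\ell)\cup N(\ell'))\setminus\{\ell,\ell'\}$: (1) $N(\ell)\cap N(\ell')\neq\emptyset$ and every agent in $N(\ell\cup\ell')$ is connected to an agent of $N(\ell)\cap N(\ell')$ by a path in $N(\ell\cup\ell')$; (2) $N(\ell)\cap N(\ell')=\emptyset$, the sets $N(\ell)\setminus\{\ell'\}$ and $N(\ell')\setminus\{\ell\}$ are nonempty, and each of them is connected by paths within itself. Let one agent, at the site $v$, be unable to move. (a) If $\sigma$ is a connected configuration and $\tau$ a simply connected configuration with the same number $n$ of agents, both occupying $v$, then there is a finite sequence of valid compression moves, none of which moves the agent at $v$, that transforms $\sigma$ into $\tau$. (b) For $\lambda>0$ consider the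 compression Markov chain with immobile agent $v$: at each step choose one of the $n$ agents and one of the six directions, independently and uniformly at random; if the chosen agent is not the one at $v$ and the move to the neighbouring site in that direction is a valid compression move from the current configuration $\sigma$ to $\sigma'$, make it with probability $\min\{1,\lambda^{e(\sigma')-e(\sigma)}\}$, where $e(\cdot)$ is the number of lattice edges between agents; otherwise stay. This chain never leaves the set of simply connected configurations of $n$ agents that occupy $v$ (so it is a Markov chain on this set), and it is irreducible on this set. -/

import Mathlib

open scoped BigOperators

namespace Compression

/-- Sites of the (infinite) triangular lattice, in lattice coordinates. -/
abbrev Site : Type := ℤ × ℤ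

/-- The six lattice directions, in cyclic order. -/
def dir : Fin 6 → Site :=
  ![(1, 0), (1, 1), (0, 1), (-1, 0), (-1, -1), (0, -1)]

theorem exists_dir_neg (d : Fin 6) : ∃ d', dir d' = -dir d := by
  revert d; decide

theorem dir_ne_zero (d : Fin 6) : dir d ≠ 0 := by
  revert d; decide

/-- The triangular lattice as a graph: each site is adjacent to exactly six others. -/
def triLattice : SimpleGraph Site where
  Adj x y := ∃ d : Fin 6, y = x + dir d
  symm := ⟨by
    rintro x y ⟨d, rfl⟩
    obtain ⟨d', h⟩ := exists_dir_neg d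
    exact ⟨d', by rw [h]; abel⟩⟩
  loopless := ⟨by
    rintro x ⟨d, h⟩
    exact dir_ne_zero d (by simpa using h.symm)⟩

/-- A configuration of (anonymous) agents: the finite set of occupied sites. -/
abbrev Config : Type := Finset Site

open Classical in
/-- The set of agents (occupied sites) adjacent to the site `l`. -/
noncomputable def nbrs (σ : Config) (l : Site) : Finset Site :=
  σ.filter fun x => triLattice.Adj l x

/-- The set of agents adjacent to `l` or to `l'`, other than those at `l`, `l'` themselves. -/
noncomputable def nbrsUnion (σ : Config) (l l' : Site) : Finset Site :=
  (nbrs σ l ∪ nbrs σ l') \ {l, l'}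

/-- The agents at `S` form a connected (in particular nonempty) subgraph of the lattice. -/
def ConnectedOn (S : Finset Site) : Prop :=
  (triLattice.induce {x | x ∈ S}).Connected

/-- No hole: every connected component of the unoccupied sites is infinite. -/
def HoleFree (σ : Config) : Prop :=
  ∀ c : (triLattice.induce {x | x ∉ σ}).ConnectedComponent, c.supp.Infinite

/-- Connected and hole-free. -/
def SimplyConnected (σ : Config) : Prop :=
  ConnectedOn σ ∧ HoleFree σ

/-- Property 1: `l` and `l'` have a common neighbouring agent, and every agent around `l`, `l'`
is joined to such a common neighbour by a path inside `nbrsUnion σ l l'`. -/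
def Property1 (σ : Config) (l l' : Site) : Prop :=
  (nbrs σ l ∩ nbrs σ l').Nonempty ∧
    ∀ x : {x | x ∈ nbrsUnion σ l l'}, ∃ s : {x | x ∈ nbrsUnion σ l l'},
      (s : Site) ∈ nbrs σ l ∩ nbrs σ l' ∧
        (triLattice.induce {x | x ∈ nbrsUnion σ l l'}).Reachable x s

/-- Property 2: `l` and `l'` have no common neighbouring agent, each of them has a neighbouring
agent other than the moving one, and each of the two neighbourhoods is connected. -/
def Property2 (σ : Config) (l l' : Site) : Prop :=
  nbrs σ l ∩ nbrs σ l' = ∅ ∧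
    ConnectedOn (nbrs σ l \ {l'}) ∧ ConnectedOn (nbrs σ l' \ {l})

/-- In configuration `σ`, moving the agent at `l` to the unoccupied adjacent site `l'` is a valid
compression move. -/
def ValidMove (σ : Config) (l l' : Site) : Prop :=
  l ∈ σ ∧ l' ∉ σ ∧ triLattice.Adj l l' ∧
    (Property1 σ l l' ∨ Property2 σ l l') ∧ (nbrs σ l).card < 5

/-- The configuration obtained from `σ` by moving the agent at `l` to `l'`. -/
def move (σ : Config) (l l' : Site) : Config :=
  insert l' (σ.erase l)

/-- One valid compression move, made by an agent other than the immobile agent at `v`. -/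
def Step (v : Site) (σ τ : Config) : Prop :=
  ∃ l l' : Site, l ≠ v ∧ ValidMove σ l l' ∧ τ = move σ l l'

/-- The number of lattice edges between agents. -/
noncomputable def edges (σ : Config) : ℕ :=
  (triLattice.induce {x | x ∈ σ}).edgeSet.ncard

open Classical in
/-- Probability that the agent at `l`, having chosen to move to `l'`, does move: never if it is
the immobile agent or if the move is not valid, and the Metropolis probability otherwise. -/
noncomputable def acceptProb (lam : ℝ) (v : Site) (σ : Config) (l l' : Site) : ℝ :=
  if l ≠ v ∧ ValidMove σ l l' then
    min 1 (lam ^ ((edges (move σ l l') : ℤ) - (edges σ : ℤ)))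
  else 0

open Classical in
/-- One-step transition probability of the compression chain with immobile agent `v`: choose a
uniform agent and a uniform direction, then move with probability `acceptProb`, else stay. -/
noncomputable def transitionProb (lam : ℝ) (v : Site) (σ τ : Config) : ℝ :=
  ∑ l ∈ σ, ∑ d : Fin 6, (1 / (6 * (σ.card : ℝ))) *
    (acceptProb lam v σ l (l + dir d) * (if τ = move σ l (l + dir d) then 1 else 0) +
      (1 - acceptProb lam v σ l (l + dir d)) * (if τ = σ then 1 else 0))

/-- The simply connected configurations of `n` agents, one of which is at `v`. -/
def State (v : Site) (n : ℕ) : Type :=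
  {σ : Config // v ∈ σ ∧ σ.card = n ∧ SimplyConnected σ}

/-- The transition matrix of the compression chain on the simply connected configurations. -/
noncomputable def transitionMatrix (lam : ℝ) (v : Site) (n : ℕ) :
    Matrix (State v n) (State v n) ℝ :=
  Matrix.of fun σ τ => transitionProb lam v σ.1 τ.1

end Compression

/-! ### The neighbourhood of a move: eight sites in a ring. -/

namespace Compression

/-! Everything passes through one canonical configuration, the vertical segment with `v` at its
lower end. Every connected configuration can be brought there (`reach_columnSegment`), and moves
starting from a hole-free configuration can be undone (`Reach.reverse`): valid moves create no hole,
and the return move could violate the bound on the number of neighbours only if the target site had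
been a one-site hole. So `σ` goes to the segment, and the segment goes to `τ`. Irreducibility
follows because every valid move of a mobile agent has positive probability.

To gather the agents in the column of `v`, enclose them in a strip of columns and narrow it. The
measure of progress is the number of agents in columns of the parity of one border. The uppermost
agent of the left border column can slide up, which does not raise this number, or step into the
next column, which lowers it, unless an agent two steps ahead on a lattice line interferes.
`exists_clear_ray` resolves this by recursion along the line, using only moves from the counted
parity to the other one.

The only real obstacle is `v` itself, at an even distance on such a line. Comparing the obstruction
met at the top of the border column with the one met at its bottom (by reflection) shows that `v`
can have neighbours only on the side away from that border (`improvable_or_left_empty`); a half turn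
treats the right border. The two borders cannot both be obstructed, since `v` has a neighbour. Hence
the number drops until a border column is empty. Once all agents are in the column of `v`, those
below `v` are carried to the top one by one. -/

theorem adj_iff {p q : Site} : triLattice.Adj p q ↔
    (q.1 = p.1 + 1 ∧ q.2 = p.2) ∨ (q.1 = p.1 + 1 ∧ q.2 = p.2 + 1) ∨ (q.1 = p.1 ∧ q.2 = p.2 + 1) ∨
    (q.1 = p.1 - 1 ∧ q.2 = p.2) ∨ (q.1 = p.1 - 1 ∧ q.2 = p.2 - 1) ∨
    (q.1 = p.1 ∧ q.2 = p.2 - 1) := by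
  constructor
  · rintro ⟨d, rfl⟩
    fin_cases d <;> simp [dir] <;> omega
  · rintro (h | h | h | h | h | h)
    · exact ⟨0, Prod.ext (by simp [dir, h]) (by simp [dir, h])⟩
    · exact ⟨1, Prod.ext (by simp [dir, h]) (by simp [dir, h])⟩
    · exact ⟨2, Prod.ext (by simp [dir, h]) (by simp [dir, h])⟩
    · exact ⟨3, Prod.ext (by simp [dir, h]; ring) (by simp [dir, h])⟩
    · exact ⟨4, Prod.ext (by simp [dir, h]; ring) (by simp [dir, h]; ring)⟩
    · exact ⟨5, Prod.ext (by simp [dir, h]) (by simp [dir, h]; ring)⟩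

theorem mem_nbrs {σ : Config} {l z : Site} : z ∈ nbrs σ l ↔ z ∈ σ ∧ triLattice.Adj l z := by
  simp [nbrs]

theorem mem_nbrsUnion {σ : Config} {l l' z : Site} : z ∈ nbrsUnion σ l l' ↔
    z ∈ σ ∧ (triLattice.Adj l z ∨ triLattice.Adj l' z) ∧ z ≠ l ∧ z ≠ l' := by
  simp only [nbrsUnion, Finset.mem_sdiff, Finset.mem_union, mem_nbrs, Finset.mem_insert,
    Finset.mem_singleton]
  tauto

theorem nbrsUnion_comm (σ : Config) (l l' : Site) : nbrsUnion σ l l' = nbrsUnion σ l' l := by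
  ext z
  simp only [mem_nbrsUnion]
  tauto

theorem reachable_closed {S : Set Site} {x y : S} (h : (triLattice.induce S).Reachable x y)
    (P : Site → Prop) (hP : ∀ p ∈ S, ∀ q ∈ S, triLattice.Adj p q → P p → P q) (hx : P x) : P y := by
  obtain ⟨w⟩ := h
  induction w with
  | nil => exact hx
  | cons hadj _ ih => exact ih (hP _ (Subtype.prop _) _ (Subtype.prop _) hadj hx)

/-- Replaces paths by predicates closed under adjacency, so that later connectivity arguments become
finite case checks around a move. -/
theorem connectedOn_iff {S : Finset Site} : ConnectedOn S ↔ S.Nonempty ∧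
    ∀ P : Site → Prop, (∀ p ∈ S, ∀ q ∈ S, triLattice.Adj p q → P p → P q) →
      ∀ p ∈ S, ∀ q ∈ S, P p → P q := by
  constructor
  · intro h
    obtain ⟨x⟩ := h.nonempty
    refine ⟨⟨x, x.2⟩, fun P hP p hp q hq hPp => ?_⟩
    exact reachable_closed (h.preconnected ⟨p, hp⟩ ⟨q, hq⟩) P hP hPp
  · rintro ⟨⟨x, hx⟩, h⟩
    have : Nonempty {x | x ∈ S} := ⟨⟨x, hx⟩⟩
    refine ⟨fun p q => ?_⟩
    have := h (fun z => ∃ hz : z ∈ S, (triLattice.induce {x | x ∈ S}).Reachable p ⟨z, hz⟩)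
      (by
        rintro a ha b hb hab ⟨_, hr⟩
        exact ⟨hb, hr.trans (SimpleGraph.Adj.reachable (by simpa using hab))⟩)
      p p.2 q q.2 ⟨p.2, SimpleGraph.Reachable.refl _⟩
    exact this.2

theorem property1_iff {σ : Config} {l l' : Site} : Property1 σ l l' ↔
    (nbrs σ l ∩ nbrs σ l').Nonempty ∧ ∀ P : Site → Prop,
      (∀ p ∈ nbrsUnion σ l l', ∀ q ∈ nbrsUnion σ l l', triLattice.Adj p q → P p → P q) →
      ∀ x ∈ nbrsUnion σ l l', P x → ∃ s ∈ nbrs σ l ∩ nbrs σ l', P s := by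
  refine and_congr_right fun _ => ⟨fun h P hP x hx hPx => ?_, fun h x => ?_⟩
  · obtain ⟨s, hs, hr⟩ := h ⟨x, hx⟩
    exact ⟨s, hs, reachable_closed hr P hP hPx⟩
  · obtain ⟨s, hs, hsm, hr⟩ := h (fun z => ∃ hz : z ∈ nbrsUnion σ l l',
        (triLattice.induce {x | x ∈ nbrsUnion σ l l'}).Reachable x ⟨z, hz⟩)
      (by
        rintro a ha b hb hab ⟨_, hr⟩
        exact ⟨hb, hr.trans (SimpleGraph.Adj.reachable (by simpa using hab))⟩)
      x x.2 ⟨x.2, SimpleGraph.Reachable.refl _⟩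
    exact ⟨⟨s, hsm⟩, hs, hr⟩

/-- The eight sites around the adjacent sites `l`, `l'`: going round, they are
`a, x₁, x₂, x₃, b, y₃, y₂, y₁`, with `a`, `b` adjacent to both, `xᵢ` to `l` and `yᵢ` to `l'`. -/
structure IsRing (l l' a b x₁ x₂ x₃ y₁ y₂ y₃ : Site) : Prop where
  adj_l : ∀ z, triLattice.Adj l z ↔ z = l' ∨ z = a ∨ z = x₁ ∨ z = x₂ ∨ z = x₃ ∨ z = b
  adj_l' : ∀ z, triLattice.Adj l' z ↔ z = l ∨ z = a ∨ z = y₁ ∨ z = y₂ ∨ z = y₃ ∨ z = b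
  nodup : [l, l', a, x₁, x₂, x₃, b, y₃, y₂, y₁].Nodup
  adj_a : ∀ z ∈ [a, x₁, x₂, x₃, b, y₃, y₂, y₁], triLattice.Adj a z ↔ z = x₁ ∨ z = y₁
  adj_b : ∀ z ∈ [a, x₁, x₂, x₃, b, y₃, y₂, y₁], triLattice.Adj b z ↔ z = x₃ ∨ z = y₃
  adj_x₁ : ∀ z ∈ [a, x₁, x₂, x₃, b, y₃, y₂, y₁], triLattice.Adj x₁ z ↔ z = a ∨ z = x₂
  adj_x₂ : ∀ z ∈ [a, x₁, x₂, x₃, b, y₃, y₂, y₁], triLattice.Adj x₂ z ↔ z = x₁ ∨ z = x₃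
  adj_x₃ : ∀ z ∈ [a, x₁, x₂, x₃, b, y₃, y₂, y₁], triLattice.Adj x₃ z ↔ z = x₂ ∨ z = b
  adj_y₁ : ∀ z ∈ [a, x₁, x₂, x₃, b, y₃, y₂, y₁], triLattice.Adj y₁ z ↔ z = a ∨ z = y₂
  adj_y₂ : ∀ z ∈ [a, x₁, x₂, x₃, b, y₃, y₂, y₁], triLattice.Adj y₂ z ↔ z = y₁ ∨ z = y₃
  adj_y₃ : ∀ z ∈ [a, x₁, x₂, x₃, b, y₃, y₂, y₁], triLattice.Adj y₃ z ↔ z = y₂ ∨ z = b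

/-- Translation invariance reduces every clause to a statement about the six direction vectors,
which is decidable. -/
theorem isRing (l : Site) (i : Fin 6) :
    IsRing l (l + dir i) (l + dir (i + 1)) (l + dir (i + 5))
      (l + dir (i + 2)) (l + dir (i + 3)) (l + dir (i + 4))
      (l + dir i + dir (i + 1)) (l + dir i + dir i) (l + dir i + dir (i + 5)) := by
  have key : ∀ u w : Site, triLattice.Adj (l + u) (l + w) ↔ ∃ d, w = u + dir d := fun u w => by
    simp only [triLattice, add_assoc, add_right_inj]
  have all : ∀ i d : Fin 6,
      d = i ∨ d = i + 1 ∨ d = i + 2 ∨ d = i + 3 ∨ d = i + 4 ∨ d = i + 5 := by decide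
  have h2 : ∀ i, dir i + dir (i + 2) = dir (i + 1) := by decide
  have h3 : ∀ i, dir i + dir (i + 3) = 0 := by decide
  have h4 : ∀ i, dir i + dir (i + 4) = dir (i + 5) := by decide
  simp only [add_assoc l]
  constructor
  · intro z
    constructor
    · rintro ⟨d, rfl⟩
      rcases all i d with rfl | rfl | rfl | rfl | rfl | rfl <;> simp
    · rintro (rfl | rfl | rfl | rfl | rfl | rfl) <;> exact ⟨_, rfl⟩
  · intro z
    constructor
    · rintro ⟨d, rfl⟩
      rcases all i d with rfl | rfl | rfl | rfl | rfl | rfl <;> simp [add_assoc, h2, h3, h4]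
    · rintro (rfl | rfl | rfl | rfl | rfl | rfl)
      · exact ⟨i + 3, by rw [add_assoc, h3, add_zero]⟩
      · exact ⟨i + 2, by rw [add_assoc, h2]⟩
      · exact ⟨i + 1, by rw [add_assoc]⟩
      · exact ⟨i, by rw [add_assoc]⟩
      · exact ⟨i + 5, by rw [add_assoc]⟩
      · exact ⟨i + 4, by rw [add_assoc, h4]⟩
  · simp only [List.nodup_cons, List.mem_cons, List.not_mem_nil, or_false, add_right_inj,
      left_eq_add, List.nodup_nil, not_false_eq_true, and_true]
    clear key all h2 h3 h4
    refine ⟨?_, ?_, ?_, ?_, ?_, ?_, ?_, ?_, ?_⟩ <;> revert i <;> decide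
  all_goals
    simp only [List.forall_mem_cons, List.not_mem_nil, false_imp_iff, implies_true, and_true, key,
      add_right_inj]
    clear key all h2 h3 h4
    revert i; decide

variable {l l' a b x₁ x₂ x₃ y₁ y₂ y₃ : Site}

theorem IsRing.symm (h : IsRing l l' a b x₁ x₂ x₃ y₁ y₂ y₃) :
    IsRing l' l a b y₁ y₂ y₃ x₁ x₂ x₃ := by
  obtain ⟨h1, h2, h3, h4, h5, h6, h7, h8, h9, h10, h11⟩ := h
  constructor
  · exact h2
  · exact h1
  · simp only [List.nodup_cons, List.mem_cons, List.not_mem_nil, or_false, not_or] at h3 ⊢; grind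
  all_goals intro z hz
  all_goals simp only [List.mem_cons, List.not_mem_nil, or_false] at *
  all_goals grind

theorem IsRing.flip (h : IsRing l l' a b x₁ x₂ x₃ y₁ y₂ y₃) :
    IsRing l l' b a x₃ x₂ x₁ y₃ y₂ y₁ := by
  obtain ⟨h1, h2, h3, h4, h5, h6, h7, h8, h9, h10, h11⟩ := h
  constructor
  · intro z; rw [h1]; tauto
  · intro z; rw [h2]; tauto
  · simp only [List.nodup_cons, List.mem_cons, List.not_mem_nil, or_false, not_or] at h3 ⊢; grind
  all_goals intro z hz
  all_goals simp only [List.mem_cons, List.not_mem_nil, or_false] at *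
  all_goals grind

/-- Each occupied site of the arc `x₁, x₂, x₃` is joined within the arc to an occupied end
`a` or `b`. -/
def Chained (a b x₁ x₂ x₃ : Prop) : Prop :=
  (x₁ → a ∨ (x₂ ∧ x₃ ∧ b)) ∧ (x₂ → (x₁ ∧ a) ∨ (x₃ ∧ b)) ∧ (x₃ → b ∨ (x₂ ∧ x₁ ∧ a))

/-- The occupied sites of the arc `x₁, x₂, x₃` form a nonempty interval. -/
def Contiguous (x₁ x₂ x₃ : Prop) : Prop :=
  (x₁ ∨ x₂ ∨ x₃) ∧ (x₁ → x₃ → x₂)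

theorem IsRing.mem_nbrsUnion (h : IsRing l l' a b x₁ x₂ x₃ y₁ y₂ y₃) {σ : Config} {z : Site} :
    z ∈ nbrsUnion σ l l' ↔ z ∈ σ ∧ z ∈ [a, x₁, x₂, x₃, b, y₃, y₂, y₁] := by
  rw [Compression.mem_nbrsUnion, h.adj_l, h.adj_l']
  have := h.nodup
  simp only [List.nodup_cons, List.mem_cons, List.not_mem_nil, or_false, not_or] at this ⊢
  grind

theorem IsRing.mem_common (h : IsRing l l' a b x₁ x₂ x₃ y₁ y₂ y₃) {σ : Config} {z : Site} :
    z ∈ nbrs σ l ∩ nbrs σ l' ↔ z ∈ σ ∧ (z = a ∨ z = b) := by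
  rw [Finset.mem_inter, mem_nbrs, mem_nbrs, h.adj_l, h.adj_l']
  have := h.nodup
  simp only [List.nodup_cons, List.mem_cons, List.not_mem_nil, or_false, not_or] at this ⊢
  grind

theorem Property1.symm {σ : Config} (h : Property1 σ l l') : Property1 σ l' l := by
  rw [property1_iff] at h ⊢
  rw [Finset.inter_comm, nbrsUnion_comm]
  exact h

end Compression

/-! ### Valid moves expressed through the occupation of the ring. -/

namespace Compression
variable {l l' a b x₁ x₂ x₃ y₁ y₂ y₃ : Site}

theorem Chained.closed {A B X₁ X₂ X₃ pa pb p₁ p₂ p₃ : Prop} (h : Chained A B X₁ X₂ X₃)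
    (s1 : X₁ → A → p₁ → pa) (s2 : X₁ → X₂ → p₁ → p₂) (s3 : X₂ → X₁ → p₂ → p₁)
    (s4 : X₂ → X₃ → p₂ → p₃) (s5 : X₃ → X₂ → p₃ → p₂) (s6 : X₃ → B → p₃ → pb)
    (hz : (X₁ ∧ p₁) ∨ (X₂ ∧ p₂) ∨ (X₃ ∧ p₃)) : (A ∧ pa) ∨ (B ∧ pb) := by
  obtain ⟨h1, h2, h3⟩ := h
  rcases hz with ⟨hx, hp⟩ | ⟨hx, hp⟩ | ⟨hx, hp⟩
  · rcases h1 hx with ha | ⟨hx2, hx3, hb⟩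
    · exact Or.inl ⟨ha, s1 hx ha hp⟩
    · exact Or.inr ⟨hb, s6 hx3 hb (s4 hx2 hx3 (s2 hx hx2 hp))⟩
  · rcases h2 hx with ⟨hx1, ha⟩ | ⟨hx3, hb⟩
    · exact Or.inl ⟨ha, s1 hx1 ha (s3 hx hx1 hp)⟩
    · exact Or.inr ⟨hb, s6 hx3 hb (s4 hx hx3 hp)⟩
  · rcases h3 hx with hb | ⟨hx2, hx1, ha⟩
    · exact Or.inr ⟨hb, s6 hx hb hp⟩
    · exact Or.inl ⟨ha, s1 hx1 ha (s3 hx2 hx1 (s5 hx hx2 hp))⟩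

theorem Contiguous.closed {X₁ X₂ X₃ p₁ p₂ p₃ : Prop} (h : Contiguous X₁ X₂ X₃)
    (s2 : X₁ → X₂ → p₁ → p₂) (s3 : X₂ → X₁ → p₂ → p₁)
    (s4 : X₂ → X₃ → p₂ → p₃) (s5 : X₃ → X₂ → p₃ → p₂)
    (hz : (X₁ ∧ p₁) ∨ (X₂ ∧ p₂) ∨ (X₃ ∧ p₃)) : (X₁ → p₁) ∧ (X₂ → p₂) ∧ (X₃ → p₃) := by
  obtain ⟨-, h2⟩ := h
  rcases hz with ⟨hx, hp⟩ | ⟨hx, hp⟩ | ⟨hx, hp⟩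
  · exact ⟨fun _ => hp, fun h => s2 hx h hp, fun h => s4 (h2 hx h) h (s2 hx (h2 hx h) hp)⟩
  · exact ⟨fun h => s3 hx h hp, fun _ => hp, fun h => s4 hx h hp⟩
  · exact ⟨fun h => s3 (h2 h hx) h (s5 hx (h2 h hx) hp), fun h => s5 hx h hp, fun _ => hp⟩

/-- Half of `Chained` for one arc; the symmetries `flip` and `symm` of the ring supply the rest. -/
theorem IsRing.chained_aux (h : IsRing l l' a b x₁ x₂ x₃ y₁ y₂ y₃) {σ : Config}
    (hp : Property1 σ l l') :
    (x₁ ∈ σ → a ∈ σ ∨ (x₂ ∈ σ ∧ x₃ ∈ σ ∧ b ∈ σ)) ∧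
      (x₂ ∈ σ → (x₁ ∈ σ ∧ a ∈ σ) ∨ (x₃ ∈ σ ∧ b ∈ σ)) := by
  rw [property1_iff] at hp
  obtain ⟨_, hp⟩ := hp
  simp only [h.mem_nbrsUnion, h.mem_common] at hp
  have hn := h.nodup
  simp only [List.nodup_cons, List.mem_cons, List.not_mem_nil, or_false, not_or] at hn
  constructor
  · intro hx
    by_contra hc
    obtain ⟨s, ⟨hs, hab⟩, hP⟩ := hp
      -- The part of the arc reachable from `x₁`; if the claim fails, it is closed and contains
      -- neither `a` nor `b`.
      (fun z => z = x₁ ∨ (z = x₂ ∧ x₂ ∈ σ) ∨ (z = x₃ ∧ x₂ ∈ σ ∧ x₃ ∈ σ)) (by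
        rintro p ⟨hp, hp'⟩ q ⟨hq, hq'⟩ hpq (rfl | ⟨rfl, _⟩ | ⟨rfl, _, _⟩)
        · rw [h.adj_x₁ q hq'] at hpq; grind
        · rw [h.adj_x₂ q hq'] at hpq; grind
        · rw [h.adj_x₃ q hq'] at hpq; grind) x₁ ⟨hx, by simp⟩ (Or.inl rfl)
    grind
  · intro hx
    by_contra hc
    obtain ⟨s, ⟨hs, hab⟩, hP⟩ := hp
      (fun z => z = x₁ ∨ z = x₂ ∨ z = x₃) (by
        rintro p ⟨hp, hp'⟩ q ⟨hq, hq'⟩ hpq (rfl | rfl | rfl)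
        · rw [h.adj_x₁ q hq'] at hpq; grind
        · rw [h.adj_x₂ q hq'] at hpq; grind
        · rw [h.adj_x₃ q hq'] at hpq; grind) x₂ ⟨hx, by simp⟩ (Or.inr (Or.inl rfl))
    grind

theorem IsRing.property1_iff (h : IsRing l l' a b x₁ x₂ x₃ y₁ y₂ y₃) {σ : Config} :
    Property1 σ l l' ↔ (a ∈ σ ∨ b ∈ σ) ∧
      Chained (a ∈ σ) (b ∈ σ) (x₁ ∈ σ) (x₂ ∈ σ) (x₃ ∈ σ) ∧
      Chained (a ∈ σ) (b ∈ σ) (y₁ ∈ σ) (y₂ ∈ σ) (y₃ ∈ σ) := by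
  constructor
  · intro hp
    refine ⟨?_, ?_, ?_⟩
    · obtain ⟨s, hs⟩ := hp.1
      rw [h.mem_common] at hs
      rcases hs with ⟨hs, rfl | rfl⟩
      exacts [Or.inl hs, Or.inr hs]
    · exact ⟨(h.chained_aux hp).1, (h.chained_aux hp).2, (h.flip.chained_aux hp).1⟩
    · exact ⟨(h.symm.chained_aux hp.symm).1, (h.symm.chained_aux hp.symm).2,
        (h.symm.flip.chained_aux hp.symm).1⟩
  · rintro ⟨hab, hx, hy⟩
    rw [Compression.property1_iff]
    refine ⟨?_, fun P hP => ?_⟩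
    · rcases hab with h1 | h1
      exacts [⟨a, h.mem_common.2 ⟨h1, Or.inl rfl⟩⟩, ⟨b, h.mem_common.2 ⟨h1, Or.inr rfl⟩⟩]
    · simp only [h.mem_nbrsUnion, h.mem_common] at hP ⊢
      have step : ∀ p q : Site, p ∈ [a, x₁, x₂, x₃, b, y₃, y₂, y₁] →
          q ∈ [a, x₁, x₂, x₃, b, y₃, y₂, y₁] → triLattice.Adj p q → p ∈ σ → q ∈ σ → P p → P q :=
        fun p q hp hq hpq hp' hq' => hP p ⟨hp', hp⟩ q ⟨hq', hq⟩ hpq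
      have s1 := step x₁ a (by simp) (by simp) ((h.adj_x₁ _ (by simp)).2 (by simp))
      have s2 := step x₁ x₂ (by simp) (by simp) ((h.adj_x₁ _ (by simp)).2 (by simp))
      have s3 := step x₂ x₁ (by simp) (by simp) ((h.adj_x₂ _ (by simp)).2 (by simp))
      have s4 := step x₂ x₃ (by simp) (by simp) ((h.adj_x₂ _ (by simp)).2 (by simp))
      have s5 := step x₃ x₂ (by simp) (by simp) ((h.adj_x₃ _ (by simp)).2 (by simp))
      have s6 := step x₃ b (by simp) (by simp) ((h.adj_x₃ _ (by simp)).2 (by simp))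
      have t1 := step y₁ a (by simp) (by simp) ((h.adj_y₁ _ (by simp)).2 (by simp))
      have t2 := step y₁ y₂ (by simp) (by simp) ((h.adj_y₁ _ (by simp)).2 (by simp))
      have t3 := step y₂ y₁ (by simp) (by simp) ((h.adj_y₂ _ (by simp)).2 (by simp))
      have t4 := step y₂ y₃ (by simp) (by simp) ((h.adj_y₂ _ (by simp)).2 (by simp))
      have t5 := step y₃ y₂ (by simp) (by simp) ((h.adj_y₃ _ (by simp)).2 (by simp))
      have t6 := step y₃ b (by simp) (by simp) ((h.adj_y₃ _ (by simp)).2 (by simp))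
      clear step hP
      rintro z ⟨hz, hzl⟩ hPz
      suffices (a ∈ σ ∧ P a) ∨ (b ∈ σ ∧ P b) by
        rcases this with ⟨h1, h2⟩ | ⟨h1, h2⟩
        exacts [⟨a, ⟨h1, Or.inl rfl⟩, h2⟩, ⟨b, ⟨h1, Or.inr rfl⟩, h2⟩]
      simp only [List.mem_cons, List.not_mem_nil, or_false] at hzl
      rcases hzl with rfl | rfl | rfl | rfl | rfl | rfl | rfl | rfl
      · exact Or.inl ⟨hz, hPz⟩
      · exact hx.closed s1 s2 s3 s4 s5 s6 (Or.inl ⟨hz, hPz⟩)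
      · exact hx.closed s1 s2 s3 s4 s5 s6 (Or.inr (Or.inl ⟨hz, hPz⟩))
      · exact hx.closed s1 s2 s3 s4 s5 s6 (Or.inr (Or.inr ⟨hz, hPz⟩))
      · exact Or.inr ⟨hz, hPz⟩
      · exact hy.closed t1 t2 t3 t4 t5 t6 (Or.inr (Or.inr ⟨hz, hPz⟩))
      · exact hy.closed t1 t2 t3 t4 t5 t6 (Or.inr (Or.inl ⟨hz, hPz⟩))
      · exact hy.closed t1 t2 t3 t4 t5 t6 (Or.inl ⟨hz, hPz⟩)

theorem IsRing.connectedOn_iff (h : IsRing l l' a b x₁ x₂ x₃ y₁ y₂ y₃) {σ : Config}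
    (ha : a ∉ σ) (hb : b ∉ σ) :
    ConnectedOn (nbrs σ l \ {l'}) ↔ Contiguous (x₁ ∈ σ) (x₂ ∈ σ) (x₃ ∈ σ) := by
  have hn := h.nodup
  simp only [List.nodup_cons, List.mem_cons, List.not_mem_nil, or_false, not_or] at hn
  have hm : ∀ z, z ∈ nbrs σ l \ {l'} ↔ z ∈ σ ∧ (z = x₁ ∨ z = x₂ ∨ z = x₃) := by
    intro z
    rw [Finset.mem_sdiff, mem_nbrs, h.adj_l, Finset.mem_singleton]
    grind
  rw [Compression.connectedOn_iff]
  simp only [hm]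
  have h1 := h.adj_x₁ x₂ (by simp)
  have h2 := h.adj_x₂ x₃ (by simp)
  have h3 := h.adj_x₂ x₁ (by simp)
  have h4 := h.adj_x₃ x₂ (by simp)
  have h5 := h.adj_x₁ x₃ (by simp)
  have h6 := h.adj_x₁ x₁ (by simp)
  constructor
  · rintro ⟨⟨z, hz⟩, hc⟩
    rw [hm] at hz
    refine ⟨by grind, fun hx1 hx3 => ?_⟩
    by_contra hx2
    have := hc (fun z => z = x₁) (by grind) x₁ ⟨hx1, by simp⟩ x₃ ⟨hx3, by simp⟩ rfl
    grind
  · rintro ⟨hne, hc⟩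
    refine ⟨?_, fun P hP => ?_⟩
    · rcases hne with h | h | h
      exacts [⟨_, (hm _).2 ⟨h, by simp⟩⟩, ⟨_, (hm _).2 ⟨h, by simp⟩⟩, ⟨_, (hm _).2 ⟨h, by simp⟩⟩]
    · clear h5 h6 hm h hn
      have s1 : x₁ ∈ σ → x₂ ∈ σ → P x₁ → P x₂ := fun u v =>
        hP _ ⟨u, by simp⟩ _ ⟨v, by simp⟩ (h1.2 (by simp))
      have s2 : x₂ ∈ σ → x₃ ∈ σ → P x₂ → P x₃ := fun u v =>
        hP _ ⟨u, by simp⟩ _ ⟨v, by simp⟩ (h2.2 (by simp))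
      have s3 : x₂ ∈ σ → x₁ ∈ σ → P x₂ → P x₁ := fun u v =>
        hP _ ⟨u, by simp⟩ _ ⟨v, by simp⟩ (h3.2 (by simp))
      have s4 : x₃ ∈ σ → x₂ ∈ σ → P x₃ → P x₂ := fun u v =>
        hP _ ⟨u, by simp⟩ _ ⟨v, by simp⟩ (h4.2 (by simp))
      rintro p ⟨hp, hp'⟩ q ⟨hq, hq'⟩ hPp
      have := Contiguous.closed ⟨hne, hc⟩ s1 s3 s2 s4 (by
        rcases hp' with rfl | rfl | rfl
        exacts [Or.inl ⟨hp, hPp⟩, Or.inr (Or.inl ⟨hp, hPp⟩), Or.inr (Or.inr ⟨hp, hPp⟩)])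
      rcases hq' with rfl | rfl | rfl
      exacts [this.1 hq, this.2.1 hq, this.2.2 hq]

theorem IsRing.property2_iff (h : IsRing l l' a b x₁ x₂ x₃ y₁ y₂ y₃) {σ : Config} :
    Property2 σ l l' ↔ a ∉ σ ∧ b ∉ σ ∧ Contiguous (x₁ ∈ σ) (x₂ ∈ σ) (x₃ ∈ σ) ∧
      Contiguous (y₁ ∈ σ) (y₂ ∈ σ) (y₃ ∈ σ) := by
  have hc : nbrs σ l ∩ nbrs σ l' = ∅ ↔ a ∉ σ ∧ b ∉ σ := by
    rw [Finset.eq_empty_iff_forall_notMem]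
    simp only [h.mem_common]
    grind
  unfold Property2
  rw [hc, and_assoc]
  refine and_congr_right fun ha => and_congr_right fun hb => ?_
  rw [h.connectedOn_iff ha hb, h.symm.connectedOn_iff ha hb]

/-- As `l'` is empty, only the five other sites around `l` can hold neighbours, so the bound fails
exactly when all five do. -/
theorem IsRing.card_nbrs_lt (h : IsRing l l' a b x₁ x₂ x₃ y₁ y₂ y₃) {σ : Config} (hl' : l' ∉ σ) :
    (nbrs σ l).card < 5 ↔ ¬(a ∈ σ ∧ b ∈ σ ∧ x₁ ∈ σ ∧ x₂ ∈ σ ∧ x₃ ∈ σ) := by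
  have hn := h.nodup
  simp only [List.nodup_cons, List.mem_cons, List.not_mem_nil, or_false, not_or] at hn
  have hsub : nbrs σ l ⊆ {a, b, x₁, x₂, x₃} := by
    intro z hz
    rw [mem_nbrs, h.adj_l] at hz
    simp only [Finset.mem_insert, Finset.mem_singleton]
    grind
  have hcard : ({a, b, x₁, x₂, x₃} : Finset Site).card = 5 := by
    rw [Finset.card_insert_of_notMem, Finset.card_insert_of_notMem, Finset.card_insert_of_notMem,
      Finset.card_insert_of_notMem, Finset.card_singleton] <;>
      simp only [Finset.mem_insert, Finset.mem_singleton] <;> grind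
  have hiff : nbrs σ l = {a, b, x₁, x₂, x₃} ↔
      (a ∈ σ ∧ b ∈ σ ∧ x₁ ∈ σ ∧ x₂ ∈ σ ∧ x₃ ∈ σ) := by
    rw [Finset.Subset.antisymm_iff, and_iff_right hsub]
    simp only [Finset.insert_subset_iff, Finset.singleton_subset_iff, mem_nbrs, h.adj_l]
    grind
  rw [← hiff]
  constructor
  · intro hlt heq
    rw [heq, hcard] at hlt
    omega
  · intro hne
    exact hcard ▸ Finset.card_lt_card (hsub.ssubset_of_ne hne)

/-- The local condition, in terms of the eight surrounding sites, for a move to be valid. -/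
structure LocalMove (l l' a b x₁ x₂ x₃ y₁ y₂ y₃ : Prop) : Prop where
  mem : l
  notMem : ¬l'
  prop : ((a ∨ b) ∧ Chained a b x₁ x₂ x₃ ∧ Chained a b y₁ y₂ y₃) ∨
    (¬a ∧ ¬b ∧ Contiguous x₁ x₂ x₃ ∧ Contiguous y₁ y₂ y₃)
  card : ¬(a ∧ b ∧ x₁ ∧ x₂ ∧ x₃)

theorem IsRing.validMove_iff (h : IsRing l l' a b x₁ x₂ x₃ y₁ y₂ y₃) {σ : Config} :
    ValidMove σ l l' ↔ LocalMove (l ∈ σ) (l' ∈ σ) (a ∈ σ) (b ∈ σ) (x₁ ∈ σ) (x₂ ∈ σ) (x₃ ∈ σ)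
      (y₁ ∈ σ) (y₂ ∈ σ) (y₃ ∈ σ) := by
  have hadj : triLattice.Adj l l' := (h.adj_l l').2 (Or.inl rfl)
  constructor
  · rintro ⟨h1, h2, -, h3, h4⟩
    rw [h.property1_iff, h.property2_iff] at h3
    exact ⟨h1, h2, h3, (h.card_nbrs_lt h2).1 h4⟩
  · rintro ⟨h1, h2, h3, h4⟩
    rw [← h.property1_iff, ← h.property2_iff] at h3
    exact ⟨h1, h2, hadj, h3, (h.card_nbrs_lt h2).2 h4⟩

end Compression

/-! ### Invariance of connectedness and hole-freeness; reversibility. -/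

namespace Compression
variable {l l' a b x₁ x₂ x₃ y₁ y₂ y₃ v : Site} {σ τ : Config}

theorem mem_move {z : Site} : z ∈ move σ l l' ↔ z = l' ∨ (z ≠ l ∧ z ∈ σ) := by
  simp [move]

theorem card_move (hl : l ∈ σ) (hl' : l' ∉ σ) : (move σ l l').card = σ.card := by
  rw [move, Finset.card_insert_of_notMem (fun h => hl' (Finset.mem_of_mem_erase h)),
    Finset.card_erase_add_one hl]

theorem ValidMove.exists_ring (h : ValidMove σ l l') :
    ∃ a b x₁ x₂ x₃ y₁ y₂ y₃, IsRing l l' a b x₁ x₂ x₃ y₁ y₂ y₃ := by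
  obtain ⟨i, rfl⟩ := h.2.2.1
  exact ⟨_, _, _, _, _, _, _, _, isRing l i⟩

theorem IsRing.mem_move (h : IsRing l l' a b x₁ x₂ x₃ y₁ y₂ y₃) {z : Site}
    (hz : z ∈ [a, x₁, x₂, x₃, b, y₃, y₂, y₁]) : z ∈ move σ l l' ↔ z ∈ σ := by
  have hn := h.nodup
  simp only [List.nodup_cons, List.mem_cons, List.not_mem_nil, or_false, not_or] at hn hz
  rw [Compression.mem_move]
  grind

/-- Under Property 1, an agent that was attached to `l` is still joined to the moved agent, through
`a` or `b`. -/
theorem IsRing.nbr_link (h : IsRing l l' a b x₁ x₂ x₃ y₁ y₂ y₃)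
    (hc : Chained (a ∈ σ) (b ∈ σ) (x₁ ∈ σ) (x₂ ∈ σ) (x₃ ∈ σ)) (hl' : l' ∉ σ) {P : Site → Prop}
    (hP : ∀ p ∈ move σ l l', ∀ q ∈ move σ l l', triLattice.Adj p q → P p → P q) {x : Site}
    (hx : x ∈ σ) (hlx : triLattice.Adj l x) (hPx : P x) : P l' := by
  have step : ∀ p q : Site, p ∈ [a, x₁, x₂, x₃, b, y₃, y₂, y₁] →
      q ∈ [a, x₁, x₂, x₃, b, y₃, y₂, y₁] → triLattice.Adj p q → p ∈ σ → q ∈ σ → P p → P q :=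
    fun p q hp hq hpq hp' hq' => hP p ((h.mem_move hp).2 hp') q ((h.mem_move hq).2 hq') hpq
  have key : (a ∈ σ ∧ P a) ∨ (b ∈ σ ∧ P b) := by
    rw [h.adj_l] at hlx
    have hcl := hc.closed (pa := P a) (pb := P b) (p₁ := P x₁) (p₂ := P x₂) (p₃ := P x₃)
      (step x₁ a (by simp) (by simp) ((h.adj_x₁ _ (by simp)).2 (by simp)))
      (step x₁ x₂ (by simp) (by simp) ((h.adj_x₁ _ (by simp)).2 (by simp)))
      (step x₂ x₁ (by simp) (by simp) ((h.adj_x₂ _ (by simp)).2 (by simp)))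
      (step x₂ x₃ (by simp) (by simp) ((h.adj_x₂ _ (by simp)).2 (by simp)))
      (step x₃ x₂ (by simp) (by simp) ((h.adj_x₃ _ (by simp)).2 (by simp)))
      (step x₃ b (by simp) (by simp) ((h.adj_x₃ _ (by simp)).2 (by simp)))
    rcases hlx with rfl | rfl | rfl | rfl | rfl | rfl
    · exact absurd hx hl'
    · exact Or.inl ⟨hx, hPx⟩
    · exact hcl (Or.inl ⟨hx, hPx⟩)
    · exact hcl (Or.inr (Or.inl ⟨hx, hPx⟩))
    · exact hcl (Or.inr (Or.inr ⟨hx, hPx⟩))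
    · exact Or.inr ⟨hx, hPx⟩
  have hm : l' ∈ move σ l l' := Compression.mem_move.2 (Or.inl rfl)
  rcases key with ⟨h1, h2⟩ | ⟨h1, h2⟩
  · exact hP a ((h.mem_move (by simp)).2 h1) l' hm ((h.adj_l' a).2 (by simp)).symm h2
  · exact hP b ((h.mem_move (by simp)).2 h1) l' hm ((h.adj_l' b).2 (by simp)).symm h2

theorem ValidMove.connectedOn (h : ValidMove σ l l') (hσ : ConnectedOn σ) :
    ConnectedOn (move σ l l') := by
  obtain ⟨a, b, x₁, x₂, x₃, y₁, y₂, y₃, hr⟩ := h.exists_ring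
  have hn := hr.nodup
  simp only [List.nodup_cons, List.mem_cons, List.not_mem_nil, or_false, not_or] at hn
  obtain ⟨hl, hl', hprop, -⟩ := hr.validMove_iff.1 h
  rw [connectedOn_iff] at hσ ⊢
  refine ⟨⟨l', mem_move.2 (Or.inl rfl)⟩, fun P hP r hp s hq hPp => ?_⟩
  have hP' : ∀ p ∈ move σ l l', ∀ q ∈ move σ l l', triLattice.Adj p q → ¬P p → ¬P q :=
    fun p hp q hq hpq h1 h2 => h1 (hP q hq p hp hpq.symm h2)
  have hlm : l' ∈ move σ l l' := mem_move.2 (Or.inl rfl)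
  have hm : ∀ z, z ∈ σ → z ≠ l → z ∈ move σ l l' := fun z hz hzl => mem_move.2 (Or.inr ⟨hzl, hz⟩)
  rcases hprop with ⟨-, hc, -⟩ | ⟨ha, hb, hx, hy⟩
  -- Pull `P` back to `σ` by giving `l` the value at `l'`.
  · have hall := hσ.2 (fun z => (z = l ∧ P l') ∨ (z ≠ l ∧ P z)) (by
      clear hp hq hPp
      rintro p hp q hq hpq (⟨rfl, h1⟩ | ⟨h0, h1⟩)
      · have hqp : q ≠ p := hpq.ne'
        refine Or.inr ⟨hqp, ?_⟩
        by_contra h2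
        exact hr.nbr_link hc hl' hP' hq hpq h2 h1
      · by_cases hql : q = l
        · subst hql
          exact Or.inl ⟨rfl, hr.nbr_link hc hl' hP hp hpq.symm h1⟩
        · exact Or.inr ⟨hql, hP p (hm p hp h0) q (hm q hq hql) hpq h1⟩)
    have h0 : P l' := by
      rcases mem_move.1 hp with rfl | ⟨h1, h2⟩
      · exact hPp
      · have := hall r h2 l hl (Or.inr ⟨h1, hPp⟩)
        simpa using this
    rcases mem_move.1 hq with rfl | ⟨h1, h2⟩
    · exact h0
    · simpa [h1] using hall l hl s h2 (Or.inl ⟨rfl, h0⟩)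
  · have step : ∀ p q : Site, p ∈ [a, x₁, x₂, x₃, b, y₃, y₂, y₁] →
        q ∈ [a, x₁, x₂, x₃, b, y₃, y₂, y₁] → triLattice.Adj p q → p ∈ σ → q ∈ σ → P p → P q :=
      fun p q hp hq hpq hp' hq' =>
        hP p ((hr.mem_move hp).2 hp') q ((hr.mem_move hq).2 hq') hpq
    have hcl := hx.closed (p₁ := P x₁) (p₂ := P x₂) (p₃ := P x₃)
      (step x₁ x₂ (by simp) (by simp) ((hr.adj_x₁ _ (by simp)).2 (by simp)))
      (step x₂ x₁ (by simp) (by simp) ((hr.adj_x₂ _ (by simp)).2 (by simp)))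
      (step x₂ x₃ (by simp) (by simp) ((hr.adj_x₂ _ (by simp)).2 (by simp)))
      (step x₃ x₂ (by simp) (by simp) ((hr.adj_x₃ _ (by simp)).2 (by simp)))
    have hadj : ∀ z ∈ σ, triLattice.Adj l z → z = x₁ ∨ z = x₂ ∨ z = x₃ := by
      intro z hz hlz
      rw [hr.adj_l] at hlz
      grind
    -- Here `l` takes the value shared by the arc of its other neighbours: since these form an
    -- interval, deleting `l` disconnects nothing.
    have hall := hσ.2 (fun z =>
        (z = l ∧ (x₁ ∈ σ → P x₁) ∧ (x₂ ∈ σ → P x₂) ∧ (x₃ ∈ σ → P x₃)) ∨ (z ≠ l ∧ P z)) (by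
      clear hp hq hPp
      rintro p hp q hq hpq (⟨rfl, h1, h2, h3⟩ | ⟨h0, h1⟩)
      · refine Or.inr ⟨hpq.ne', ?_⟩
        rcases hadj q hq hpq with rfl | rfl | rfl
        exacts [h1 hq, h2 hq, h3 hq]
      · by_cases hql : q = l
        · subst hql
          refine Or.inl ⟨rfl, hcl ?_⟩
          rcases hadj p hp hpq.symm with rfl | rfl | rfl
          exacts [Or.inl ⟨hp, h1⟩, Or.inr (Or.inl ⟨hp, h1⟩), Or.inr (Or.inr ⟨hp, h1⟩)]
        · exact Or.inr ⟨hql, hP p (hm p hp h0) q (hm q hq hql) hpq h1⟩)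
    obtain ⟨y, hyσ, hyl, hyadj⟩ : ∃ y ∈ σ, y ≠ l ∧ triLattice.Adj l' y := by
      rcases hy.1 with h | h | h
      · exact ⟨y₁, h, by grind, (hr.adj_l' _).2 (by simp)⟩
      · exact ⟨y₂, h, by grind, (hr.adj_l' _).2 (by simp)⟩
      · exact ⟨y₃, h, by grind, (hr.adj_l' _).2 (by simp)⟩
    have h0 : P y := by
      rcases mem_move.1 hp with rfl | ⟨h1, h2⟩
      · exact hP r hlm y (hm y hyσ hyl) hyadj hPp
      · simpa [hyl] using hall r h2 y hyσ (Or.inr ⟨h1, hPp⟩)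
    rcases mem_move.1 hq with rfl | ⟨h1, h2⟩
    · exact hP y (hm y hyσ hyl) s hlm hyadj.symm h0
    · simpa [h1] using hall y hyσ s h2 (Or.inr ⟨hyl, h0⟩)

/-- A finite set of empty sites closed under adjacency among empty sites is a union of finite
components, so such sets can stand in for holes. -/
theorem holeFree_iff : HoleFree σ ↔ ∀ K : Set Site, K.Finite → K.Nonempty → (∀ p ∈ K, p ∉ σ) →
    ¬∀ p ∈ K, ∀ q, q ∉ σ → triLattice.Adj p q → q ∈ K := by
  constructor
  · rintro h K hfin ⟨z, hz⟩ hK hcl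
    have := h ((triLattice.induce {x | x ∉ σ}).connectedComponentMk ⟨z, hK z hz⟩)
    refine this.image Subtype.val_injective.injOn (hfin.subset ?_)
    rintro _ ⟨w, hw, rfl⟩
    rw [SimpleGraph.ConnectedComponent.mem_supp_iff, SimpleGraph.ConnectedComponent.eq] at hw
    exact reachable_closed hw.symm (· ∈ K) (fun p _ q hq hpq hp => hcl p hp q hq hpq) hz
  · intro h c
    by_contra hfin
    rw [Set.not_infinite] at hfin
    refine h (Subtype.val '' c.supp) (hfin.image _) (c.nonempty_supp.image _) ?_ ?_
    · rintro _ ⟨w, -, rfl⟩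
      exact w.2
    · rintro _ ⟨w, hw, rfl⟩ q hq hpq
      refine ⟨⟨q, hq⟩, ?_, rfl⟩
      rw [SimpleGraph.ConnectedComponent.mem_supp_iff] at hw ⊢
      rw [← hw, SimpleGraph.ConnectedComponent.eq]
      exact SimpleGraph.Adj.reachable (by simpa using hpq.symm)

theorem ValidMove.not_full (h : ValidMove σ l l') (hσ : HoleFree σ)
    (hr : IsRing l l' a b x₁ x₂ x₃ y₁ y₂ y₃) :
    ¬(a ∈ σ ∧ b ∈ σ ∧ y₁ ∈ σ ∧ y₂ ∈ σ ∧ y₃ ∈ σ) := by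
  intro hf
  have hl := h.1
  refine holeFree_iff.1 hσ {l'} (Set.finite_singleton _) (Set.singleton_nonempty _) ?_ ?_
  · rintro p rfl
    exact h.2.1
  · rintro p rfl q hq hpq
    rw [hr.adj_l'] at hpq
    grind

theorem ValidMove.reverse (h : ValidMove σ l l') (hσ : HoleFree σ) :
    ValidMove (move σ l l') l' l := by
  obtain ⟨a, b, x₁, x₂, x₃, y₁, y₂, y₃, hr⟩ := h.exists_ring
  have hf := h.not_full hσ hr
  obtain ⟨hl, hl', hprop, -⟩ := hr.validMove_iff.1 h
  rw [hr.symm.validMove_iff, hr.mem_move (z := a) (by simp), hr.mem_move (z := b) (by simp),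
    hr.mem_move (z := x₁) (by simp), hr.mem_move (z := x₂) (by simp),
    hr.mem_move (z := x₃) (by simp), hr.mem_move (z := y₁) (by simp),
    hr.mem_move (z := y₂) (by simp), hr.mem_move (z := y₃) (by simp)]
  refine ⟨mem_move.2 (Or.inl rfl), fun h1 => ?_, ?_, hf⟩
  · rcases mem_move.1 h1 with rfl | h2
    · exact hl' hl
    · exact h2.1 rfl
  · rcases hprop with ⟨h1, h2, h3⟩ | ⟨h1, h2, h3, h4⟩
    · exact Or.inl ⟨h1, h3, h2⟩
    · exact Or.inr ⟨h1, h2, h4, h3⟩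

theorem move_reverse (hl : l ∈ σ) (hl' : l' ∉ σ) : move (move σ l l') l' l = σ := by
  ext z
  rw [mem_move, mem_move]
  grind

/-- The `k`s record membership in a set closed among the empty sites after the move. Under Property
1 the empty sites of the arc from `a` to `b` around `l'` form one interval; under Property 2 they
form at most two pieces, containing `a` and `b`, joined through the vacated `l`. So the set contains
all of them or none. -/
theorem LocalMove.link {L L' A B X₁ X₂ X₃ Y₁ Y₂ Y₃ kl ka kb k₁ k₂ k₃ : Prop}
    (h : LocalMove L L' A B X₁ X₂ X₃ Y₁ Y₂ Y₃)
    (e1 : ¬A → (kl ↔ ka)) (e2 : ¬B → (kl ↔ kb)) (e3 : ¬A → ¬Y₁ → (ka ↔ k₁))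
    (e4 : ¬Y₁ → ¬Y₂ → (k₁ ↔ k₂)) (e5 : ¬Y₂ → ¬Y₃ → (k₂ ↔ k₃)) (e6 : ¬Y₃ → ¬B → (k₃ ↔ kb))
    (ht : (¬A ∧ ka) ∨ (¬B ∧ kb) ∨ (¬Y₁ ∧ k₁) ∨ (¬Y₂ ∧ k₂) ∨ (¬Y₃ ∧ k₃)) :
    (¬A → ka) ∧ (¬B → kb) ∧ (¬Y₁ → k₁) ∧ (¬Y₂ → k₂) ∧ (¬Y₃ → k₃) := by
  obtain ⟨-, -, h, -⟩ := h
  simp only [Chained, Contiguous] at h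
  by_cases A <;> by_cases B <;> by_cases Y₁ <;> by_cases Y₂ <;> by_cases Y₃ <;> simp_all

theorem ValidMove.holeFree (h : ValidMove σ l l') (hσ : HoleFree σ) :
    HoleFree (move σ l l') := by
  obtain ⟨a, b, x₁, x₂, x₃, y₁, y₂, y₃, hr⟩ := h.exists_ring
  have hloc := hr.validMove_iff.1 h
  have hcard := hloc.card
  have hl := hloc.mem
  have hl' := hloc.notMem
  rw [holeFree_iff] at hσ ⊢
  intro K hfin hne hK hcl
  have hll : l ∉ move σ l l' := fun h1 => by
    rcases mem_move.1 h1 with rfl | h2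
    · exact hl' hl
    · exact h2.1 rfl
  have hm : ∀ z, z ∉ σ → z ≠ l' → z ∉ move σ l l' := fun z h1 h2 h3 => by
    rcases mem_move.1 h3 with h4 | h4
    exacts [h2 h4, h1 h4.2]
  have hl'K : l' ∉ K := fun h1 => hK l' h1 (mem_move.2 (Or.inl rfl))
  have hKσ : ∀ p ∈ K, p ≠ l → p ∉ σ := fun p hp hpl hpσ => hK p hp (mem_move.2 (Or.inr ⟨hpl, hpσ⟩))
  by_cases hT : ∃ t ∈ K, t ≠ l ∧ triLattice.Adj l' t
  · obtain ⟨t, htK, htl, ht⟩ := hT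
    have hcl' : ∀ p q : Site, p ∉ move σ l l' → q ∉ move σ l l' → triLattice.Adj p q →
        (p ∈ K ↔ q ∈ K) := fun p q hp hq hpq =>
      ⟨fun h => hcl p h q hq hpq, fun h => hcl q h p hp hpq.symm⟩
    have hring : ∀ z, z ∈ [a, x₁, x₂, x₃, b, y₃, y₂, y₁] → z ∉ σ → z ∉ move σ l l' :=
      fun z hz h1 => by rwa [hr.mem_move hz]
    have hlink := hloc.link (kl := l ∈ K) (ka := a ∈ K) (kb := b ∈ K) (k₁ := y₁ ∈ K)
      (k₂ := y₂ ∈ K) (k₃ := y₃ ∈ K)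
      (fun h => hcl' _ _ hll (hring _ (by simp) h) ((hr.adj_l _).2 (by simp)))
      (fun h => hcl' _ _ hll (hring _ (by simp) h) ((hr.adj_l _).2 (by simp)))
      (fun h h' => hcl' _ _ (hring _ (by simp) h) (hring _ (by simp) h')
        ((hr.adj_a _ (by simp)).2 (by simp)))
      (fun h h' => hcl' _ _ (hring _ (by simp) h) (hring _ (by simp) h')
        ((hr.adj_y₁ _ (by simp)).2 (by simp)))
      (fun h h' => hcl' _ _ (hring _ (by simp) h) (hring _ (by simp) h')
        ((hr.adj_y₂ _ (by simp)).2 (by simp)))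
      (fun h h' => hcl' _ _ (hring _ (by simp) h) (hring _ (by simp) h')
        ((hr.adj_y₃ _ (by simp)).2 (by simp)))
      (by have := hKσ t htK htl; rw [hr.adj_l'] at ht; grind)
    -- Trading `l` for `l'` turns a finite closed set after the move into one before it; `hlink`
    -- gives closedness at `l'`.
    refine hσ (insert l' (K \ {l})) ((hfin.subset Set.sdiff_subset).insert _)
      ⟨l', Set.mem_insert _ _⟩ ?_ ?_
    · rintro p (rfl | ⟨hp, hpl⟩)
      exacts [hl', hKσ p hp hpl]
    · rintro p hp q hq hpq
      have hql : q ≠ l := fun h => hq (h ▸ hl)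
      by_cases hql' : q = l'
      · exact Or.inl hql'
      refine Or.inr ⟨?_, hql⟩
      rcases hp with rfl | ⟨hp, hpl⟩
      · rw [hr.adj_l'] at hpq
        grind
      · exact hcl p hp q (hm q hq hql') hpq
  · push Not at hT
    refine hσ (K \ {l}) (hfin.subset Set.sdiff_subset) ?_ (fun p hp => hKσ p hp.1 hp.2) ?_
    -- If `K` is just `{l}`, all other neighbours of `l` are occupied, which the bound of fewer than
    -- five excludes.
    · by_contra hemp
      rw [Set.not_nonempty_iff_eq_empty, Set.sdiff_eq_empty] at hemp
      obtain ⟨z, hz⟩ := hne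
      obtain rfl : z = l := hemp hz
      have hn := hr.nodup
      simp only [List.nodup_cons, List.mem_cons, List.not_mem_nil, or_false, not_or] at hn
      have hin : ∀ w, w ∈ [a, x₁, x₂, x₃, b, y₃, y₂, y₁] → triLattice.Adj z w → w ∈ σ := by
        intro w hw hzw
        by_contra hwσ
        have h1 := hcl z hz w (by rwa [hr.mem_move hw]) hzw
        exact hzw.ne (hemp h1).symm
      exact hcard ⟨hin _ (by simp) ((hr.adj_l _).2 (by simp)),
        hin _ (by simp) ((hr.adj_l _).2 (by simp)), hin _ (by simp) ((hr.adj_l _).2 (by simp)),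
        hin _ (by simp) ((hr.adj_l _).2 (by simp)), hin _ (by simp) ((hr.adj_l _).2 (by simp))⟩
    · rintro p ⟨hp, hpl⟩ q hq hpq
      have hql : q ≠ l := fun h => hq (h ▸ hl)
      refine ⟨?_, hql⟩
      by_cases hql' : q = l'
      · subst hql'
        exact absurd hpq.symm (hT p hp hpl)
      · exact hcl p hp q (hm q hq hql') hpq

theorem Step.connectedOn (h : Step v σ τ) (hσ : ConnectedOn σ) : ConnectedOn τ := by
  obtain ⟨l, l', -, h, rfl⟩ := h
  exact h.connectedOn hσ

theorem Step.holeFree (h : Step v σ τ) (hσ : HoleFree σ) : HoleFree τ := by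
  obtain ⟨l, l', -, h, rfl⟩ := h
  exact h.holeFree hσ

theorem Step.card_eq (h : Step v σ τ) : τ.card = σ.card := by
  obtain ⟨l, l', -, h, rfl⟩ := h
  exact card_move h.1 h.2.1

theorem Step.mem (h : Step v σ τ) (hv : v ∈ σ) : v ∈ τ := by
  obtain ⟨l, l', hl, h, rfl⟩ := h
  exact mem_move.2 (Or.inr ⟨hl.symm, hv⟩)

theorem Step.reverse (h : Step v σ τ) (hv : v ∈ σ) (hσ : HoleFree σ) : Step v τ σ := by
  obtain ⟨l, l', hl, h, rfl⟩ := h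
  exact ⟨l', l, fun he => h.2.1 (he ▸ hv), h.reverse hσ, (move_reverse h.1 h.2.1).symm⟩

/-- `τ` is reached from `σ` by moves that leave the agent at `v` alone. -/
abbrev Reach (v : Site) : Config → Config → Prop := Relation.ReflTransGen (Step v)

theorem Reach.connectedOn (h : Reach v σ τ) (hσ : ConnectedOn σ) : ConnectedOn τ := by
  induction h with
  | refl => exact hσ
  | tail _ h ih => exact h.connectedOn ih

theorem Reach.card_eq (h : Reach v σ τ) : τ.card = σ.card := by
  induction h with
  | refl => rfl
  | tail _ h ih => exact h.card_eq.trans ih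

theorem Reach.mem (h : Reach v σ τ) (hv : v ∈ σ) : v ∈ τ := by
  induction h with
  | refl => exact hv
  | tail _ h ih => exact h.mem ih

theorem Reach.reverse (h : Reach v σ τ) (hv : v ∈ σ) (hσ : HoleFree σ) : Reach v τ σ := by
  induction h using Relation.ReflTransGen.head_induction_on with
  | refl => exact .refl
  | head h _ ih => exact (ih (h.mem hv) (h.holeFree hσ)).tail (h.reverse hv hσ)

end Compression

/-! ### Clearing a ray with parity-lowering moves. -/

namespace Compression
variable {v : Site} {σ τ : Config} {x₀ x₁ : ℤ}

/-- A move of an agent from a column of the parity of `x₀` to a column of the other parity between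
`x₀` and `x₁`. -/
def ParityStep (v : Site) (x₀ x₁ : ℤ) (σ τ : Config) : Prop :=
  ∃ l l' : Site, l ≠ v ∧ ValidMove σ l l' ∧ τ = move σ l l' ∧ Even (l.1 - x₀) ∧
    ¬Even (l'.1 - x₀) ∧ x₀ ≤ l'.1 ∧ l'.1 ≤ x₁

/-- The three sites behind `k`, as seen in the direction `i`, are unoccupied. -/
def BackEmpty (σ : Config) (i : Fin 6) (k : Site) : Prop :=
  k + dir (i + 2) ∉ σ ∧ k + dir (i + 3) ∉ σ ∧ k + dir (i + 4) ∉ σ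

/-- The occupied sites among the three in front of `k`, as seen in the direction `i`, form a
nonempty interval. -/
def FrontContiguous (σ : Config) (i : Fin 6) (k : Site) : Prop :=
  Contiguous (k + dir (i + 5) ∈ σ) (k + dir i ∈ σ) (k + dir (i + 1) ∈ σ)

theorem dir_add_two (i : Fin 6) : dir i + dir (i + 2) = dir (i + 1) := by revert i; decide

theorem dir_add_three (i : Fin 6) : dir i + dir (i + 3) = 0 := by revert i; decide

theorem dir_add_four (i : Fin 6) : dir i + dir (i + 4) = dir (i + 5) := by revert i; decide

/-- The ring of the backward move from two steps ahead of `k` to one step ahead, named relative to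
`k` so that it can be compared with the ring of the forward move of `k`. -/
theorem isRing_back (k : Site) (i : Fin 6) :
    IsRing (k + dir i + dir i) (k + dir i) (k + dir i + dir (i + 5)) (k + dir i + dir (i + 1))
      (k + dir i + dir i + dir (i + 5)) (k + dir i + dir i + dir i)
      (k + dir i + dir i + dir (i + 1)) (k + dir (i + 5)) k (k + dir (i + 1)) := by
  have e1 : i + 3 + 1 = i + 4 := by revert i; decide
  have e2 : i + 3 + 2 = i + 5 := by revert i; decide
  have e3 : i + 3 + 3 = i := by revert i; decide
  have e4 : i + 3 + 4 = i + 1 := by revert i; decide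
  have e5 : i + 3 + 5 = i + 2 := by revert i; decide
  have h := isRing (k + dir i + dir i) (i + 3)
  have h3 : k + dir i + dir i + dir (i + 3) = k + dir i := by rw [add_assoc, dir_add_three, add_zero]
  have h3' : k + dir i + dir (i + 3) = k := by rw [add_assoc, dir_add_three, add_zero]
  have h4 : k + dir i + dir i + dir (i + 4) = k + dir i + dir (i + 5) := by
    rw [add_assoc, dir_add_four]
  have h4' : k + dir i + dir (i + 4) = k + dir (i + 5) := by rw [add_assoc, dir_add_four]
  have h2 : k + dir i + dir i + dir (i + 2) = k + dir i + dir (i + 1) := by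
    rw [add_assoc, dir_add_two]
  have h2' : k + dir i + dir (i + 2) = k + dir (i + 1) := by rw [add_assoc, dir_add_two]
  rwa [e1, e2, e3, e4, e5, h3, h3', h4, h4', h2, h2'] at h

/-- Either the immobile agent blocks the ray from `k` in direction `i`, or moves along this ray
make room at `k` or make the neighbourhood of `k` connected. -/
theorem exists_clear_ray {i : Fin 6} (hi : i = 0 ∨ i = 1) (hx : ∀ p ∈ σ, p.1 ≤ x₁)
    (hiso : ∀ p ∈ σ, ∃ j, p + dir j ∈ σ) (N : ℕ) : ∀ k ∈ σ, BackEmpty σ i k →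
      (∀ p ∈ σ, p.1 < k.1 + N) → Even (k.1 - x₀) → x₀ ≤ k.1 →
      (k.1 ≤ v.1 ∧ v.2 - k.2 = (v.1 - k.1) * (dir i).2 ∧ Even (v.1 - k.1) ∧ BackEmpty σ i v) ∨
      (k ≠ v ∧ ∃ σ', Relation.ReflTransGen (ParityStep v x₀ x₁) σ σ' ∧
        (∀ p : Site, p.1 < k.1 ∨ p.2 - k.2 ≠ (p.1 - k.1) * (dir i).2 → (p ∈ σ' ↔ p ∈ σ)) ∧
        (k ∈ σ' → FrontContiguous σ' i k)) := by
  have hd1 : (dir i).1 = 1 := by rcases hi with rfl | rfl <;> rfl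
  have hE : (dir (i + 1)).2 ≠ (dir (i + 1)).1 * (dir i).2 := by
    rcases hi with rfl | rfl <;> decide
  have hF : (dir (i + 5)).2 ≠ (dir (i + 5)).1 * (dir i).2 := by
    rcases hi with rfl | rfl <;> decide
  -- One of the two flanking sites lies in the column of `k + dir i`; when both are occupied, that
  -- column is therefore within the strip.
  have hmax : (dir (i + 1)).1 = 1 ∨ (dir (i + 5)).1 = 1 := by
    rcases hi with rfl | rfl <;> decide
  induction N with
  | zero =>
    intro k hk _ hN
    simpa using hN k hk
  | succ N ih =>
    intro k hk hb hN hpar hx₀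
    obtain ⟨hb2, hb3, hb4⟩ := hb
    by_cases hkv : k = v
    · subst hkv
      exact Or.inl ⟨le_rfl, by simp, by simp, hb2, hb3, hb4⟩
    by_cases hfr : FrontContiguous σ i k
    · exact Or.inr ⟨hkv, σ, .refl, fun _ _ => Iff.rfl, fun _ => hfr⟩
    have hne : k + dir i ∈ σ ∨ k + dir (i + 1) ∈ σ ∨ k + dir (i + 5) ∈ σ := by
      obtain ⟨j, hj⟩ := hiso k hk
      have : j = i ∨ j = i + 1 ∨ j = i + 2 ∨ j = i + 3 ∨ j = i + 4 ∨ j = i + 5 := by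
        clear * -; revert i j; decide
      rcases this with rfl | rfl | rfl | rfl | rfl | rfl
      exacts [Or.inl hj, Or.inr (Or.inl hj), absurd hj hb2, absurd hj hb3, absurd hj hb4,
        Or.inr (Or.inr hj)]
    -- A nonempty subset of three consecutive sites that is not an interval consists of the two
    -- ends.
    obtain ⟨hke, hkf, hkd⟩ : k + dir (i + 1) ∈ σ ∧ k + dir (i + 5) ∈ σ ∧ k + dir i ∉ σ := by
      have hd : k + dir i ∉ σ := fun h => hfr ⟨Or.inr (Or.inl h), fun _ _ => h⟩
      by_contra hc
      refine hfr ⟨by tauto, fun h1 h2 => absurd ⟨h2, h1, hd⟩ hc⟩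
    have hd₁ : (k + dir i).1 = k.1 + 1 := by rw [Prod.fst_add, hd1]
    have hodd : ¬Even ((k + dir i).1 - x₀) := by
      rw [hd₁, add_sub_right_comm, Int.even_add_one, not_not]
      exact hpar
    have hdx₁ : (k + dir i).1 ≤ x₁ := by
      rcases hmax with h | h
      · have := hx _ hke
        rw [Prod.fst_add, h] at this
        omega
      · have := hx _ hkf
        rw [Prod.fst_add, h] at this
        omega
    have hrest : ∀ {τ : Config}, (k ∈ τ ∧ k + dir (i + 1) ∈ τ ∧ k + dir (i + 5) ∈ τ ∧
        k + dir i ∉ τ ∧ k + dir (i + 2) ∉ τ ∧ k + dir (i + 3) ∉ τ ∧ k + dir (i + 4) ∉ τ) →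
        (k + dir i + dir i ∈ τ → k + dir i + dir (i + 1) ∈ τ ∨ k + dir i + dir (i + 5) ∈ τ) →
        ParityStep v x₀ x₁ τ (move τ k (k + dir i)) := by
      rintro τ ⟨h1, h2, h3, h4, h5, h6, h7⟩ h8
      refine ⟨k, k + dir i, hkv, (isRing k i).validMove_iff.2 ⟨h1, h4,
        Or.inl ⟨Or.inl h2, ⟨fun h => absurd h h5, fun h => absurd h h6, fun h => absurd h h7⟩,
          fun _ => Or.inl h2, fun h => ?_, fun _ => Or.inl h3⟩, fun h => h5 h.2.2.1⟩, rfl,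
        hpar, hodd, by omega, hdx₁⟩
      exact (h8 h).imp (fun h => ⟨h, h2⟩) (fun h => ⟨h, h3⟩)
    have hoff : ∀ p : Site, p.1 < k.1 ∨ p.2 - k.2 ≠ (p.1 - k.1) * (dir i).2 →
        p ≠ k ∧ p ≠ k + dir i := by
      intro p h
      constructor
      · rintro rfl
        simp at h
      · rintro rfl
        simp [hd1] at h
    -- The agent at `k` can step into the gap by Property 1 unless the site two ahead is occupied
    -- and both sites joining it to the flanks are empty. In that case the site two ahead has an
    -- empty back, and the induction applies to it.
    by_cases hent : k + dir i + dir i ∈ σ → k + dir i + dir (i + 1) ∈ σ ∨ k + dir i + dir (i + 5) ∈ σ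
    · refine Or.inr ⟨hkv, _, .single (hrest ⟨hk, hke, hkf, hkd, hb2, hb3, hb4⟩ hent), fun p hp => ?_,
        fun hk' => ?_⟩
      · obtain ⟨h1, h2⟩ := hoff p hp
        rw [mem_move]
        simp [h1, h2]
      · rw [mem_move] at hk'
        rcases hk' with hk' | hk'
        · exact absurd hk (by rw [hk']; exact hkd)
        · exact absurd rfl hk'.1
    · push Not at hent
      obtain ⟨hk2, hk2e, hk2f⟩ := hent
      have hd₂ : (k + dir i + dir i).1 = k.1 + 2 := by rw [Prod.fst_add, hd₁, hd1]; ring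
      have hd₂' : (k + dir i + dir i).2 = k.2 + 2 * (dir i).2 := by
        simp only [Prod.snd_add]; ring
      have hback : ∀ {τ : Config}, (k + dir i ∉ τ ∧ k + dir i + dir (i + 1) ∉ τ ∧
          k + dir i + dir (i + 5) ∉ τ) → BackEmpty τ i (k + dir i + dir i) := by
        rintro τ ⟨h1, h2, h3⟩
        refine ⟨?_, ?_, ?_⟩
        · rwa [add_assoc, dir_add_two]
        · rwa [add_assoc, dir_add_three, add_zero]
        · rwa [add_assoc, dir_add_four]
      have hpar2 : Even ((k + dir i + dir i).1 - x₀) := by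
        rw [hd₂, add_sub_right_comm]
        exact hpar.add even_two
      by_cases hk2v : k + dir i + dir i = v
      · refine Or.inl ⟨by rw [← hk2v, hd₂]; omega, by rw [← hk2v, hd₂, hd₂']; ring,
          by rw [← hk2v, hd₂]; simp, hk2v ▸ hback ⟨hkd, hk2e, hk2f⟩⟩
      rcases ih _ hk2 (hback ⟨hkd, hk2e, hk2f⟩) (fun p hp => by
          have := hN p hp
          push_cast at this ⊢
          omega) hpar2 (by omega) with ⟨h1, h2, h3, h4⟩ | ⟨-, σ', hreach, hag, hfront⟩
      · refine Or.inl ⟨by omega, ?_, ?_, h4⟩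
        · rw [hd₂, hd₂'] at h2
          linear_combination h2
        · rw [hd₂] at h3
          have := h3.add even_two
          rwa [show v.1 - (k.1 + 2) + 2 = v.1 - k.1 by ring] at this
      have hag' : ∀ u : Site, (u.1 < 2 ∨ u.2 ≠ u.1 * (dir i).2) → (k + u ∈ σ' ↔ k + u ∈ σ) := by
        intro u hu
        refine hag _ ?_
        rw [hd₂, hd₂', Prod.fst_add, Prod.snd_add]
        rcases hu with hu | hu
        · exact Or.inl (by omega)
        · refine Or.inr fun h => hu ?_
          linear_combination h
      have g0 : k ∈ σ' ↔ k ∈ σ := by simpa using hag' 0 (by simp)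
      have gd := hag' (dir i) (Or.inl (by omega))
      have ge := hag' (dir (i + 1)) (Or.inr hE)
      have gf := hag' (dir (i + 5)) (Or.inr hF)
      have gb2 := hag' (dir (i + 2)) (Or.inl (by generalize i + 2 = j; revert j; decide))
      have gb3 := hag' (dir (i + 3)) (Or.inl (by generalize i + 3 = j; revert j; decide))
      have gb4 := hag' (dir (i + 4)) (Or.inl (by generalize i + 4 = j; revert j; decide))
      have gde := hag' (dir i + dir (i + 1)) (Or.inr (by
        rw [Prod.fst_add, Prod.snd_add, hd1]
        intro h
        exact hE (by linear_combination h)))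
      have gdf := hag' (dir i + dir (i + 5)) (Or.inr (by
        rw [Prod.fst_add, Prod.snd_add, hd1]
        intro h
        exact hF (by linear_combination h)))
      rw [← add_assoc] at gde gdf
      have hfar : ∀ p : Site, p.1 < k.1 ∨ p.2 - k.2 ≠ (p.1 - k.1) * (dir i).2 →
          (p ∈ σ' ↔ p ∈ σ) ∧ p ≠ k + dir i + dir i := by
        intro p hp
        refine ⟨hag p ?_, ?_⟩
        · rw [hd₂, hd₂']
          rcases hp with hp | hp
          · exact Or.inl (by omega)
          · exact Or.inr fun h => hp (by linear_combination h)
        · rintro rfl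
          rw [hd₂, hd₂'] at hp
          rcases hp with hp | hp
          · omega
          · exact hp (by ring)
      have hbase : k ∈ σ' ∧ k + dir (i + 1) ∈ σ' ∧ k + dir (i + 5) ∈ σ' ∧
          k + dir i ∉ σ' ∧ k + dir (i + 2) ∉ σ' ∧ k + dir (i + 3) ∉ σ' ∧ k + dir (i + 4) ∉ σ' := by
        rw [g0, gd, ge, gf, gb2, gb3, gb4]
        exact ⟨hk, hke, hkf, hkd, hb2, hb3, hb4⟩
      -- If the agent two ahead is still there, its front is now an interval, and it steps back into
      -- the gap by Property 2, making the front of `k` full. Otherwise nothing hinders `k` from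
      -- stepping forward.
      by_cases hmem : k + dir i + dir i ∈ σ'
      · have hstep : ParityStep v x₀ x₁ σ' (move σ' (k + dir i + dir i) (k + dir i)) := by
          refine ⟨_, _, hk2v, (isRing_back k i).validMove_iff.2 ⟨hmem, hbase.2.2.2.1, Or.inr ?_, ?_⟩,
            rfl, hpar2, hodd, by omega, hdx₁⟩
          · refine ⟨by rwa [gdf], by rwa [gde], hfront hmem, ?_⟩
            exact ⟨Or.inl hbase.2.2.1, fun _ _ => hbase.1⟩
          · exact fun h => absurd h.1 (by rwa [gdf])
        refine Or.inr ⟨hkv, _, hreach.tail hstep, fun p hp => ?_, fun _ => ?_⟩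
        · obtain ⟨h1, h1'⟩ := hoff p hp
          obtain ⟨h2, h2'⟩ := hfar p hp
          rw [mem_move]
          simp [h1', h2, h2']
        · have hm : k + dir i ∈ move σ' (k + dir i + dir i) (k + dir i) := mem_move.2 (Or.inl rfl)
          exact ⟨Or.inr (Or.inl hm), fun _ _ => hm⟩
      · refine Or.inr ⟨hkv, _, hreach.tail (hrest hbase fun h => absurd h hmem), fun p hp => ?_,
          fun hk' => ?_⟩
        · obtain ⟨h1, h1'⟩ := hoff p hp
          obtain ⟨h2, h2'⟩ := hfar p hp
          rw [mem_move]
          simp [h1, h1', h2]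
        · rw [mem_move] at hk'
          rcases hk' with hk' | hk'
          · exact absurd hk (by rw [hk']; exact hkd)
          · exact absurd rfl hk'.1

end Compression

/-! ### Emptying the left border column from above. -/

namespace Compression
variable {v : Site} {σ τ : Config} {x₀ x₁ : ℤ}

/-- The number of agents in the columns of the parity of `x₀`. -/
def parityCount (x₀ : ℤ) (σ : Config) : ℕ := (σ.filter fun p => Even (p.1 - x₀)).card

/-- All agents are in the columns from `x₀` to `x₁`. -/
def InStrip (x₀ x₁ : ℤ) (σ : Config) : Prop := ∀ p ∈ σ, x₀ ≤ p.1 ∧ p.1 ≤ x₁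

theorem ParityStep.step (h : ParityStep v x₀ x₁ σ τ) : Step v σ τ := by
  obtain ⟨l, l', h1, h2, h3, -⟩ := h
  exact ⟨l, l', h1, h2, h3⟩

theorem ParityStep.inStrip (h : ParityStep v x₀ x₁ σ τ) (hσ : InStrip x₀ x₁ σ) :
    InStrip x₀ x₁ τ := by
  obtain ⟨l, l', -, h2, rfl, -, -, h4, h5⟩ := h
  intro p hp
  rcases mem_move.1 hp with rfl | hp
  exacts [⟨h4, h5⟩, hσ p hp.2]

theorem ParityStep.parityCount_lt (h : ParityStep v x₀ x₁ σ τ) :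
    parityCount x₀ τ < parityCount x₀ σ := by
  obtain ⟨l, l', -, h2, rfl, h3, h4, -⟩ := h
  refine Finset.card_lt_card ⟨fun p hp => ?_, fun hs => ?_⟩
  · rw [Finset.mem_filter, mem_move] at hp
    rw [Finset.mem_filter]
    rcases hp with ⟨rfl | hp, hpe⟩
    exacts [absurd hpe h4, ⟨hp.2, hpe⟩]
  · have := hs (Finset.mem_filter.2 ⟨h2.1, h3⟩)
    rw [Finset.mem_filter, mem_move] at this
    rcases this with ⟨rfl | hp, -⟩
    exacts [h4 h3, hp.1 rfl]

/-- Moves within the strip lead to a configuration with fewer agents in the columns of the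
parity of `x₀`. -/
def Improvable (v : Site) (x₀ x₁ : ℤ) (σ : Config) : Prop :=
  ∃ τ, Reach v σ τ ∧ InStrip x₀ x₁ τ ∧ parityCount x₀ τ < parityCount x₀ σ

theorem improvable_of_transGen (h : Relation.TransGen (ParityStep v x₀ x₁) σ τ)
    (hσ : InStrip x₀ x₁ σ) : Improvable v x₀ x₁ σ := by
  refine ⟨τ, Relation.ReflTransGen.mono (fun _ _ h => ParityStep.step h) _ _ h.to_reflTransGen, ?_, ?_⟩
  · induction h with
    | single h => exact h.inStrip hσ
    | tail _ h ih => exact h.inStrip ih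
  · induction h with
    | single h => exact h.parityCount_lt
    | tail _ h ih => exact h.parityCount_lt.trans ih

theorem ConnectedOn.exists_nbr (h : ConnectedOn σ) {p q : Site} (hp : p ∈ σ) (hq : q ∈ σ)
    (hpq : p ≠ q) : ∃ j, p + dir j ∈ σ := by
  by_contra hc
  push Not at hc
  have := (connectedOn_iff.1 h).2 (fun z => z = p) (by
    rintro a ha b hb ⟨j, rfl⟩ rfl
    exact absurd hb (hc j)) p hp q hq rfl
  exact hpq this.symm

theorem isRing_right (x y : ℤ) : IsRing (x, y) (x + 1, y) (x + 1, y + 1) (x, y - 1)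
    (x, y + 1) (x - 1, y) (x - 1, y - 1) (x + 2, y + 1) (x + 2, y) (x + 1, y - 1) := by
  convert isRing (x, y) 0 using 1 <;> ext <;> simp [dir] <;> ring

theorem isRing_upRight (x y : ℤ) : IsRing (x, y) (x + 1, y + 1) (x, y + 1) (x + 1, y)
    (x - 1, y) (x - 1, y - 1) (x, y - 1) (x + 1, y + 2) (x + 2, y + 2) (x + 2, y + 1) := by
  convert isRing (x, y) 1 using 1 <;> ext <;> simp [dir] <;> ring

theorem isRing_up (x y : ℤ) : IsRing (x, y) (x, y + 1) (x - 1, y) (x + 1, y + 1)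
    (x - 1, y - 1) (x, y - 1) (x + 1, y) (x - 1, y + 1) (x, y + 2) (x + 1, y + 2) := by
  convert isRing (x, y) 2 using 1 <;> ext <;> simp [dir] <;> ring

theorem isRing_left (x y : ℤ) : IsRing (x + 2, y) (x + 1, y) (x + 1, y - 1) (x + 2, y + 1)
    (x + 2, y - 1) (x + 3, y) (x + 3, y + 1) (x, y - 1) (x, y) (x + 1, y + 1) := by
  convert isRing_back (x, y) 0 using 1 <;> ext <;> simp [dir] <;> ring

theorem isRing_downLeft (x y : ℤ) : IsRing (x + 2, y + 2) (x + 1, y + 1) (x + 2, y + 1)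
    (x + 1, y + 2) (x + 3, y + 2) (x + 3, y + 3) (x + 2, y + 3) (x + 1, y) (x, y) (x, y + 1) := by
  convert isRing_back (x, y) 1 using 1 <;> ext <;> simp [dir] <;> ring

theorem backEmpty_zero {x y : ℤ} : BackEmpty σ 0 (x, y) ↔
    (x, y + 1) ∉ σ ∧ (x - 1, y) ∉ σ ∧ (x - 1, y - 1) ∉ σ := by
  simp [BackEmpty, dir, sub_eq_add_neg]

theorem backEmpty_one {x y : ℤ} : BackEmpty σ 1 (x, y) ↔
    (x - 1, y) ∉ σ ∧ (x - 1, y - 1) ∉ σ ∧ (x, y - 1) ∉ σ := by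
  simp [BackEmpty, dir, sub_eq_add_neg]

theorem frontContiguous_zero {x y : ℤ} : FrontContiguous σ 0 (x, y) ↔
    Contiguous ((x, y - 1) ∈ σ) ((x + 1, y) ∈ σ) ((x + 1, y + 1) ∈ σ) := by
  simp [FrontContiguous, dir, sub_eq_add_neg]

theorem frontContiguous_one {x y : ℤ} : FrontContiguous σ 1 (x, y) ↔
    Contiguous ((x + 1, y) ∈ σ) ((x + 1, y + 1) ∈ σ) ((x, y + 1) ∈ σ) := by
  simp [FrontContiguous, dir]

/-- The immobile agent obstructs moving the uppermost agent of column `x₀` to the right. -/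
def Obstructed (v : Site) (x₀ : ℤ) (σ : Config) : Prop :=
  Even (v.1 - x₀) ∧
    ((BackEmpty σ 0 v ∧ (∃ p ∈ σ, ∃ q ∈ σ, p ≠ q ∧ p.1 = x₀ ∧ q.1 = x₀) ∧
        ∀ p ∈ σ, p.1 = x₀ → p.2 ≤ v.2) ∨
      (BackEmpty σ 1 v ∧ ∀ p ∈ σ, p.1 = x₀ → p.2 - v.2 ≤ x₀ - v.1))

/-- By parity `v` lies at least two columns to the right, so the slide does not touch its
neighbourhood; and a slide only raises agents, so upper bounds on heights pass back to `σ`. This is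
why `Obstructed` uses inequalities. -/
theorem obstructed_of_move_up {y : ℤ} (hxv : x₀ < v.1) (hc : (x₀, y) ∈ σ)
    (h : Obstructed v x₀ (move σ (x₀, y) (x₀, y + 1))) : Obstructed v x₀ σ := by
  obtain ⟨hev, h⟩ := h
  have hv2 : x₀ + 2 ≤ v.1 := by
    rcases hev with ⟨r, hr⟩
    omega
  have hmem : ∀ p : Site, p.1 ≠ x₀ → (p ∈ move σ (x₀, y) (x₀, y + 1) ↔ p ∈ σ) := by
    intro p hp
    have h1 : p ≠ (x₀, y) := fun h => hp (by rw [h])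
    have h2 : p ≠ (x₀, y + 1) := fun h => hp (by rw [h])
    simp [mem_move, h1, h2]
  have hback : ∀ i, BackEmpty (move σ (x₀, y) (x₀, y + 1)) i v → BackEmpty σ i v := by
    rintro i ⟨h1, h2, h3⟩
    have hd : ∀ j, (v + dir j).1 ≠ x₀ := by
      intro j
      have : -1 ≤ (dir j).1 := by revert j; decide
      rw [Prod.fst_add]
      omega
    exact ⟨by rwa [hmem _ (hd _)] at h1, by rwa [hmem _ (hd _)] at h2, by rwa [hmem _ (hd _)] at h3⟩
  have hnew : (x₀, y + 1) ∈ move σ (x₀, y) (x₀, y + 1) := mem_move.2 (Or.inl rfl)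
  have hcol : ∀ p ∈ σ, p.1 = x₀ → ∃ q ∈ move σ (x₀, y) (x₀, y + 1), q.1 = x₀ ∧ p.2 ≤ q.2 := by
    intro p hp hpx
    by_cases hpc : p = (x₀, y)
    · exact ⟨_, hnew, rfl, by rw [hpc]; simp⟩
    · exact ⟨p, mem_move.2 (Or.inr ⟨hpc, hp⟩), hpx, le_rfl⟩
  refine ⟨hev, ?_⟩
  rcases h with ⟨h1, ⟨p, hp, q, hq, hpq, hpx, hqx⟩, h3⟩ | ⟨h1, h2⟩
  · refine Or.inl ⟨hback _ h1, ?_, fun p hp hpx => ?_⟩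
    · rcases mem_move.1 hp with rfl | ⟨hp1, hp2⟩
      · rcases mem_move.1 hq with rfl | ⟨hq1, hq2⟩
        · exact absurd rfl hpq
        · exact ⟨q, hq2, _, hc, hq1, hqx, rfl⟩
      · exact ⟨p, hp2, _, hc, hp1, hpx, rfl⟩
    · obtain ⟨q, hq, hqx, hle⟩ := hcol p hp hpx
      exact hle.trans (h3 q hq hqx)
  · refine Or.inr ⟨hback _ h1, fun p hp hpx => ?_⟩
    obtain ⟨q, hq, hqx, hle⟩ := hcol p hp hpx
    have := h2 q hq hqx
    omega

/-- A slide stays in its column and hence does not raise the parity count, so a later decrease is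
also a decrease from `σ`. -/
theorem improvable_of_move_up {y : ℤ} (hv : v.1 ≠ x₀)
    (hm : ValidMove σ (x₀, y) (x₀, y + 1))
    (h : Improvable v x₀ x₁ (move σ (x₀, y) (x₀, y + 1))) : Improvable v x₀ x₁ σ := by
  obtain ⟨τ, h1, h2, h3⟩ := h
  refine ⟨τ, Relation.ReflTransGen.head ⟨_, _, fun h => hv (by rw [← h]), hm, rfl⟩ h1, h2,
    h3.trans_le ?_⟩
  have : (move σ (x₀, y) (x₀, y + 1)).filter (fun p => Even (p.1 - x₀)) ⊆
      insert (x₀, y + 1) ((σ.filter fun p => Even (p.1 - x₀)).erase (x₀, y)) := by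
    intro p hp
    rw [Finset.mem_filter, mem_move] at hp
    rw [Finset.mem_insert, Finset.mem_erase, Finset.mem_filter]
    tauto
  refine (Finset.card_le_card this).trans ((Finset.card_insert_le _ _).trans ?_)
  rw [Finset.card_erase_add_one (Finset.mem_filter.2 ⟨hm.1, by simp⟩)]
  rfl

/-- The case analysis on the sites near the top agent of the border column. Sliding up is left to
`hslide`; it is invoked only when some agent is at height `y + 1` or more, which makes the recursion
on slides terminate. -/
theorem improvable_or_obstructed_of_slide {y : ℤ} (hconn : ConnectedOn σ) (hvσ : v ∈ σ)
    (hxv : x₀ < v.1) (hs : InStrip x₀ x₁ σ) (hc : (x₀, y) ∈ σ)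
    (htop : ∀ p ∈ σ, p.1 = x₀ → p.2 ≤ y)
    (hslide : ValidMove σ (x₀, y) (x₀, y + 1) → (∃ p ∈ σ, y + 1 ≤ p.2) →
      Improvable v x₀ x₁ σ ∨ Obstructed v x₀ σ) :
    Improvable v x₀ x₁ σ ∨ Obstructed v x₀ σ := by
  have hcv : (x₀, y) ≠ v := fun h => hxv.ne (by rw [← h])
  have hx1 : x₀ + 1 ≤ x₁ := by have := (hs v hvσ).2; omega
  have hL : ∀ z, (x₀ - 1, z) ∉ σ := fun z h => by have := (hs _ h).1; simp at this
  have hT1 : (x₀, y + 1) ∉ σ := fun h => by have := htop _ h rfl; simp at this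
  have hT2 : (x₀, y + 2) ∉ σ := fun h => by have := htop _ h rfl; simp at this
  have hiso : ∀ p ∈ σ, ∃ j, p + dir j ∈ σ := fun p hp => by
    by_cases hpv : p = v
    · exact hconn.exists_nbr hp hc (hpv ▸ hcv.symm)
    · exact hconn.exists_nbr hp hvσ hpv
  have hbd : ∀ k : Site, ∀ p ∈ σ, p.1 < k.1 + (x₁ + 1 - k.1).toNat := fun k p hp => by
    have := (hs p hp).2
    omega
  have ray : ∀ i, i = 0 ∨ i = 1 → ∀ k ∈ σ, BackEmpty σ i k → Even (k.1 - x₀) → _ :=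
    fun i hi k hk hb he => exists_clear_ray (v := v) (x₁ := x₁) hi (fun p hp => (hs p hp).2) hiso _ k hk hb
      (hbd k) he (hs k hk).1
  have done : ∀ {σ' τ}, Relation.ReflTransGen (ParityStep v x₀ x₁) σ σ' →
      ParityStep v x₀ x₁ σ' τ → Improvable v x₀ x₁ σ ∨ Obstructed v x₀ σ := fun h1 h2 =>
    Or.inl (improvable_of_transGen (Relation.TransGen.tail' h1 h2) hs)
  have enter : ∀ {σ' : Config} {z : ℤ}, ValidMove σ' (x₀, y) (x₀ + 1, z) →
      ParityStep v x₀ x₁ σ' (move σ' (x₀, y) (x₀ + 1, z)) := fun h =>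
    ⟨_, _, hcv, h, rfl, by simp, by simp, by simp, hx1⟩
  have hpar2 : Even (x₀ + 2 - x₀) := by simp
  by_cases hU : (x₀ + 1, y + 1) ∈ σ
  · by_cases hchev : (x₀, y - 1) ∈ σ ∧ (x₀ + 1, y) ∉ σ
    · obtain ⟨hD, hR⟩ := hchev
      rcases ray 0 (Or.inl rfl) _ hc (backEmpty_zero.2 ⟨hT1, hL _, hL _⟩) (by simp) with
        ⟨-, h2, h3, h4⟩ | ⟨hkv, σ', h1, h2, h3⟩
      · have h2 : v.2 - y = 0 := by simpa [dir] using h2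
        refine Or.inr ⟨h3, Or.inl ⟨h4, ⟨_, hc, _, hD, by simp; omega, rfl, rfl⟩, fun p hp hpx => ?_⟩⟩
        have := htop p hp hpx
        omega
      -- The front of the top agent has a gap, so the sequence of moves cannot be empty; any one of
      -- its moves is already an improvement.
      · rcases Relation.reflTransGen_iff_eq_or_transGen.1 h1 with h | h
        · subst h
          have := (frontContiguous_zero.1 (h3 hc)).2 hD hU
          exact absurd this hR
        · exact Or.inl (improvable_of_transGen h hs)
    · refine hslide ((isRing_up x₀ y).validMove_iff.2 ⟨hc, hT1, Or.inl ⟨Or.inr hU, ?_, ?_⟩, ?_⟩)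
        ⟨_, hU, le_rfl⟩
      · exact ⟨fun h => absurd h (hL _), fun h => Or.inr ⟨by tauto, hU⟩, fun _ => Or.inl hU⟩
      · exact ⟨fun h => absurd h (hL _), fun h => absurd h hT2, fun _ => Or.inl hU⟩
      · exact fun h => hL _ h.1
  by_cases hR : (x₀ + 1, y) ∈ σ
  · by_cases hW : (x₀ + 1, y + 2) ∈ σ
    · refine hslide ((isRing_up x₀ y).validMove_iff.2 ⟨hc, hT1, Or.inr ⟨hL _, hU, ?_, ?_⟩, ?_⟩)
        ⟨_, hW, by simp⟩
      · exact ⟨Or.inr (Or.inr hR), fun h => absurd h (hL _)⟩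
      · exact ⟨Or.inr (Or.inr hW), fun h => absurd h (hL _)⟩
      · exact fun h => hL _ h.1
    -- Stepping to the upper right, with `(x₀ + 1, y)` as common neighbour, fails only if `(x₀ + 2,
    -- y + 2)` is occupied without `(x₀ + 2, y + 1)`. The diagonal ray from there is then cleared,
    -- or its first agent steps down-left.
    have mv : ∀ σ' : Config, (x₀, y) ∈ σ' → (x₀ + 1, y + 1) ∉ σ' → (x₀ + 1, y) ∈ σ' →
        (∀ z, (x₀ - 1, z) ∉ σ') → (x₀ + 1, y + 2) ∉ σ' → (x₀, y + 1) ∉ σ' →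
        ((x₀ + 2, y + 2) ∈ σ' → (x₀ + 2, y + 1) ∈ σ') → ValidMove σ' (x₀, y) (x₀ + 1, y + 1) := by
      intro σ' g1 g2 g3 g4 g5 g6 g7
      refine (isRing_upRight x₀ y).validMove_iff.2 ⟨g1, g2, Or.inl ⟨Or.inr g3, ?_, ?_⟩, ?_⟩
      · exact ⟨fun h => absurd h (g4 _), fun h => absurd h (g4 _), fun _ => Or.inl g3⟩
      · exact ⟨fun h => absurd h g5, fun h => Or.inr ⟨g7 h, g3⟩, fun _ => Or.inl g3⟩
      · exact fun h => g6 h.1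
    by_cases hK : (x₀ + 2, y + 2) ∈ σ → (x₀ + 2, y + 1) ∈ σ
    · exact done .refl (enter (mv σ hc hU hR hL hW hT1 hK))
    push Not at hK
    obtain ⟨hK, hK'⟩ := hK
    rcases ray 1 (Or.inr rfl) _ hK (backEmpty_one.2 ⟨by convert hW using 3; ring,
        by convert hU using 3 <;> ring, by convert hK' using 3; ring⟩) hpar2 with
      ⟨h1, h2, h3, h4⟩ | ⟨hkv, σ', h1, h2, h3⟩
    · have h2 : v.2 - (y + 2) = v.1 - (x₀ + 2) := by simpa [dir] using h2
      refine Or.inr ⟨?_, Or.inr ⟨h4, fun p hp hpx => ?_⟩⟩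
      · have := h3.add hpar2
        rwa [show v.1 - (x₀ + 2, y + 2).1 + (x₀ + 2 - x₀) = v.1 - x₀ by ring] at this
      · have := htop p hp hpx
        omega
    · have e : ∀ p : Site, p.1 < x₀ + 2 ∨ p.2 - (y + 2) ≠ p.1 - (x₀ + 2) → (p ∈ σ' ↔ p ∈ σ) := by
        simpa [dir] using h2
      have ec := e (x₀, y) (by simp)
      have eU := e (x₀ + 1, y + 1) (by simp)
      have eR := e (x₀ + 1, y) (by simp)
      have eL := fun z => e (x₀ - 1, z) (Or.inl (by dsimp only; omega))
      have eW := e (x₀ + 1, y + 2) (by simp)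
      have eT := e (x₀, y + 1) (by simp)
      have eK := e (x₀ + 2, y + 1) (by simp)
      by_cases hk : (x₀ + 2, y + 2) ∈ σ'
      · refine done h1 ⟨_, _, hkv, (isRing_downLeft x₀ y).validMove_iff.2
          ⟨hk, by rwa [eU], Or.inr ⟨by rwa [eK], by rwa [eW], ?_, ?_⟩, ?_⟩, rfl, by simp, by simp,
          by simp, hx1⟩
        · have := frontContiguous_one.1 (h3 hk)
          convert this using 3 <;> ring
        · exact ⟨Or.inl (by rwa [eR]), fun _ _ => by rwa [ec]⟩
        · exact fun h => hK' (eK.1 h.1)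
      · exact done h1 (enter (mv σ' (by rwa [ec]) (by rwa [eU]) (by rwa [eR])
          (fun z => by rw [eL]; exact hL z) (by rwa [eW]) (by rwa [eT]) fun h => absurd h hk))
  · have hD : (x₀, y - 1) ∈ σ := by
      obtain ⟨j, hj⟩ := hiso _ hc
      fin_cases j <;> simp [dir, ← sub_eq_add_neg] at hj
      exacts [absurd hj hR, absurd hj hU, absurd hj hT1, absurd hj (hL _), absurd hj (hL _), hj]
    -- The horizontal counterpart: the common neighbour is `(x₀, y - 1)`, and the possible blocker
    -- is `(x₀ + 2, y)`.
    have mv : ∀ σ' : Config, (x₀, y) ∈ σ' → (x₀ + 1, y + 1) ∉ σ' → (x₀ + 1, y) ∉ σ' →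
        (∀ z, (x₀ - 1, z) ∉ σ') → (x₀, y + 1) ∉ σ' → (x₀, y - 1) ∈ σ' → (x₀ + 2, y + 1) ∉ σ' →
        ((x₀ + 2, y) ∈ σ' → (x₀ + 1, y - 1) ∈ σ') → ValidMove σ' (x₀, y) (x₀ + 1, y) := by
      intro σ' g1 g2 g3 g4 g5 g6 g7 g8
      refine (isRing_right x₀ y).validMove_iff.2 ⟨g1, g3, Or.inl ⟨Or.inr g6, ?_, ?_⟩, ?_⟩
      · exact ⟨fun h => absurd h g5, fun h => absurd h (g4 _), fun h => absurd h (g4 _)⟩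
      · exact ⟨fun h => absurd h g7, fun h => Or.inr ⟨g8 h, g6⟩, fun _ => Or.inl g6⟩
      · exact fun h => g2 h.1
    by_cases hF : (x₀ + 2, y + 1) ∈ σ
    · by_cases hW : (x₀ + 1, y + 2) ∈ σ
      · refine hslide ((isRing_up x₀ y).validMove_iff.2 ⟨hc, hT1, Or.inr ⟨hL _, hU, ?_, ?_⟩, ?_⟩)
          ⟨_, hW, by simp⟩
        · exact ⟨Or.inr (Or.inl hD), fun h => absurd h (hL _)⟩
        · exact ⟨Or.inr (Or.inr hW), fun h => absurd h (hL _)⟩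
        · exact fun h => hL _ h.1
      · refine done .refl (enter ((isRing_upRight x₀ y).validMove_iff.2
          ⟨hc, hU, Or.inr ⟨hT1, hR, ?_, ?_⟩, ?_⟩))
        · exact ⟨Or.inr (Or.inr hD), fun h => absurd h (hL _)⟩
        · exact ⟨Or.inr (Or.inr hF), fun h => absurd h hW⟩
        · exact fun h => hT1 h.1
    by_cases hK : (x₀ + 2, y) ∈ σ → (x₀ + 1, y - 1) ∈ σ
    · exact done .refl (enter (mv σ hc hU hR hL hT1 hD hF hK))
    push Not at hK
    obtain ⟨hK, hK'⟩ := hK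
    rcases ray 0 (Or.inl rfl) _ hK (backEmpty_zero.2 ⟨hF, by convert hR using 3; ring,
        by convert hK' using 3; ring⟩) hpar2 with
      ⟨h1, h2, h3, h4⟩ | ⟨hkv, σ', h1, h2, h3⟩
    · have h2 : v.2 - y = 0 := by simpa [dir] using h2
      refine Or.inr ⟨?_, Or.inl ⟨h4, ⟨_, hc, _, hD, by simp; omega, rfl, rfl⟩, fun p hp hpx => ?_⟩⟩
      · have := h3.add hpar2
        rwa [show v.1 - (x₀ + 2, y).1 + (x₀ + 2 - x₀) = v.1 - x₀ by ring] at this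
      · have := htop p hp hpx
        omega
    · have e : ∀ p : Site, p.1 < x₀ + 2 ∨ p.2 - y ≠ 0 → (p ∈ σ' ↔ p ∈ σ) := by
        simpa [dir] using h2
      have ec := e (x₀, y) (by simp)
      have eU := e (x₀ + 1, y + 1) (by simp)
      have eR := e (x₀ + 1, y) (by simp)
      have eL := fun z => e (x₀ - 1, z) (Or.inl (by dsimp only; omega))
      have eT := e (x₀, y + 1) (by simp)
      have eD := e (x₀, y - 1) (by simp)
      have eF := e (x₀ + 2, y + 1) (by simp)
      have eK := e (x₀ + 1, y - 1) (by simp)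
      by_cases hk : (x₀ + 2, y) ∈ σ'
      · refine done h1 ⟨_, _, hkv, (isRing_left x₀ y).validMove_iff.2
          ⟨hk, by rwa [eR], Or.inr ⟨by rwa [eK], by rwa [eF], ?_, ?_⟩, ?_⟩, rfl, by simp, by simp,
          by simp, hx1⟩
        · have := frontContiguous_zero.1 (h3 hk)
          convert this using 3 <;> ring
        · exact ⟨Or.inl (by rwa [eD]), fun _ h => absurd (eU.1 h) hU⟩
        · exact fun h => hK' (eK.1 h.1)
      · exact done h1 (enter (mv σ' (by rwa [ec]) (by rwa [eU]) (by rwa [eR])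
          (fun z => by rw [eL]; exact hL z) (by rwa [eT]) (by rwa [eD]) (by rwa [eF])
          fun h => absurd h hk))

theorem improvable_or_obstructed_top (M : ℤ) (m : ℕ) : ∀ (σ : Config) (y : ℤ), M - y ≤ m →
    (∀ p ∈ σ, p.2 ≤ M) → ConnectedOn σ → v ∈ σ → x₀ < v.1 → InStrip x₀ x₁ σ → (x₀, y) ∈ σ →
    (∀ p ∈ σ, p.1 = x₀ → p.2 ≤ y) → Improvable v x₀ x₁ σ ∨ Obstructed v x₀ σ := by
  induction m with
  | zero =>
    intro σ y hm hM hconn hvσ hxv hs hc htop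
    refine improvable_or_obstructed_of_slide hconn hvσ hxv hs hc htop fun _ ⟨p, hp, hpy⟩ => ?_
    have := hM p hp
    push_cast at hm
    omega
  | succ m ih =>
    intro σ y hm hM hconn hvσ hxv hs hc htop
    refine improvable_or_obstructed_of_slide hconn hvσ hxv hs hc htop fun hmv ⟨p, hp, hpy⟩ => ?_
    have hpM := hM p hp
    have hcv : (x₀, y) ≠ v := fun h => hxv.ne (by rw [← h])
    refine (ih (move σ (x₀, y) (x₀, y + 1)) (y + 1) (by push_cast at hm; omega) ?_
      (hmv.connectedOn hconn) (mem_move.2 (Or.inr ⟨hcv.symm, hvσ⟩)) hxv ?_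
      (mem_move.2 (Or.inl rfl)) ?_).imp
      (improvable_of_move_up hxv.ne' hmv) (obstructed_of_move_up hxv hc)
    · intro q hq
      rcases mem_move.1 hq with rfl | ⟨-, hq⟩
      exacts [by simpa using hpy.trans hpM, hM q hq]
    · intro q hq
      rcases mem_move.1 hq with rfl | ⟨-, hq⟩
      exacts [⟨le_rfl, (hs _ hc).2⟩, hs q hq]
    · intro q hq hqx
      rcases mem_move.1 hq with rfl | ⟨-, hq⟩
      exacts [le_rfl, (htop q hq hqx).trans (by omega)]

end Compression

/-! ### Lattice symmetries and the shrinking strip. -/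

namespace Compression
variable {v l l' a b z₁ z₂ z₃ y₁ y₂ y₃ : Site} {σ τ : Config} {x₀ x₁ : ℤ}

/-- The image of a configuration under a symmetry of the lattice. -/
def Config.image (e : triLattice ≃g triLattice) (σ : Config) : Config :=
  σ.map e.toEquiv.toEmbedding

theorem mem_image {e : triLattice ≃g triLattice} {z : Site} :
    z ∈ Config.image e σ ↔ e.symm z ∈ σ := Finset.mem_map_equiv

theorem apply_mem_image {e : triLattice ≃g triLattice} {z : Site} :
    e z ∈ Config.image e σ ↔ z ∈ σ := by
  rw [mem_image, RelIso.symm_apply_apply]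

theorem image_symm_image (e : triLattice ≃g triLattice) (σ : Config) :
    Config.image e.symm (Config.image e σ) = σ := by
  ext z
  rw [mem_image, mem_image]
  exact iff_of_eq (congrArg (· ∈ σ) (e.symm_apply_apply z))

theorem IsRing.image (h : IsRing l l' a b z₁ z₂ z₃ y₁ y₂ y₃) (e : triLattice ≃g triLattice) :
    IsRing (e l) (e l') (e a) (e b) (e z₁) (e z₂) (e z₃) (e y₁) (e y₂) (e y₃) := by
  obtain ⟨h1, h2, h3, h4, h5, h6, h7, h8, h9, h10, h11⟩ := h
  have hadj : ∀ p q, triLattice.Adj (e p) (e q) ↔ triLattice.Adj p q := fun p q => e.map_adj_iff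
  constructor
  · intro z
    obtain ⟨z, rfl⟩ := e.surjective z
    simpa only [hadj, e.injective.eq_iff] using h1 z
  · intro z
    obtain ⟨z, rfl⟩ := e.surjective z
    simpa only [hadj, e.injective.eq_iff] using h2 z
  · exact h3.map e.injective
  all_goals
    intro z hz
    obtain ⟨z, rfl⟩ := e.surjective z
    simp only [List.mem_cons, List.not_mem_nil, or_false, hadj, e.injective.eq_iff] at *
  exacts [h4 z hz, h5 z hz, h6 z hz, h7 z hz, h8 z hz, h9 z hz, h10 z hz, h11 z hz]

theorem Step.image (h : Step v σ τ) (e : triLattice ≃g triLattice) :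
    Step (e v) (Config.image e σ) (Config.image e τ) := by
  obtain ⟨l, l', hl, h, rfl⟩ := h
  refine ⟨e l, e l', e.injective.ne hl, ?_, ?_⟩
  · obtain ⟨a, b, z₁, z₂, z₃, y₁, y₂, y₃, hr⟩ := h.exists_ring
    rw [(hr.image e).validMove_iff]
    simpa only [apply_mem_image] using hr.validMove_iff.1 h
  · ext z
    obtain ⟨z, rfl⟩ := e.surjective z
    simp only [mem_move, apply_mem_image, ne_eq, e.injective.eq_iff]

theorem Reach.image (h : Reach v σ τ) (e : triLattice ≃g triLattice) :
    Reach (e v) (Config.image e σ) (Config.image e τ) := by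
  induction h with
  | refl => exact .refl
  | tail _ h ih => exact ih.tail (h.image e)

theorem Reach.of_image {e : triLattice ≃g triLattice} (h : Reach (e v) (Config.image e σ) τ) :
    Reach v σ (Config.image e.symm τ) := by
  have := Reach.image h e.symm
  rwa [image_symm_image, RelIso.symm_apply_apply] at this

theorem ConnectedOn.image (h : ConnectedOn σ) (e : triLattice ≃g triLattice) :
    ConnectedOn (Config.image e σ) := by
  rw [connectedOn_iff] at h ⊢
  obtain ⟨⟨z, hz⟩, h⟩ := h
  refine ⟨⟨e z, apply_mem_image.2 hz⟩, fun P hP p hp q hq => ?_⟩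
  obtain ⟨p, rfl⟩ := e.surjective p
  obtain ⟨q, rfl⟩ := e.surjective q
  rw [apply_mem_image] at hp hq
  exact h (fun z => P (e z)) (fun p hp q hq hpq => hP _ (apply_mem_image.2 hp) _
    (apply_mem_image.2 hq) (e.map_adj_iff.2 hpq)) p hp q hq

/-- The reflection of the lattice that fixes each column. -/
def mirror : triLattice ≃g triLattice where
  toFun p := (p.1, p.1 - p.2)
  invFun p := (p.1, p.1 - p.2)
  left_inv p := by simp
  right_inv p := by simp
  map_rel_iff' {p q} := by
    simp only [Equiv.coe_fn_mk, adj_iff]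
    omega

/-- The half turn of the lattice about the origin. -/
def halfTurn : triLattice ≃g triLattice where
  toFun p := (-p.1, -p.2)
  invFun p := (-p.1, -p.2)
  left_inv p := by simp
  right_inv p := by simp
  map_rel_iff' {p q} := by
    simp only [Equiv.coe_fn_mk, adj_iff]
    omega

theorem mirror_apply (p : Site) : mirror p = (p.1, p.1 - p.2) := rfl
theorem mirror_symm_apply (p : Site) : mirror.symm p = (p.1, p.1 - p.2) := rfl
theorem halfTurn_apply (p : Site) : halfTurn p = (-p.1, -p.2) := rfl
theorem halfTurn_symm_apply (p : Site) : halfTurn.symm p = (-p.1, -p.2) := rfl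

theorem parityCount_image {e : triLattice ≃g triLattice} {x x' : ℤ}
    (h : ∀ p, Even ((e p).1 - x') ↔ Even (p.1 - x)) :
    parityCount x' (Config.image e σ) = parityCount x σ := by
  rw [parityCount, parityCount, Config.image, Finset.filter_map, Finset.card_map]
  congr 1
  exact Finset.filter_congr fun p _ => h p

theorem improvable_or_obstructed (hconn : ConnectedOn σ) (hvσ : v ∈ σ) (hxv : x₀ < v.1)
    (hs : InStrip x₀ x₁ σ) (hne : ∃ p ∈ σ, p.1 = x₀) :
    Improvable v x₀ x₁ σ ∨ Obstructed v x₀ σ := by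
  obtain ⟨M, -, hM⟩ := σ.exists_max_image (fun p => p.2) ⟨v, hvσ⟩
  obtain ⟨p, hp, hpx⟩ := hne
  obtain ⟨c, hc, hmax⟩ := (σ.filter fun p => p.1 = x₀).exists_max_image (fun p => p.2)
    ⟨p, Finset.mem_filter.2 ⟨hp, hpx⟩⟩
  obtain ⟨hc, hcx⟩ := Finset.mem_filter.1 hc
  refine improvable_or_obstructed_top M.2 (M.2 - c.2).toNat σ c.2 (by omega) hM hconn hvσ hxv hs
    (by rw [← hcx]; exact hc) fun q hq hqx => hmax q (Finset.mem_filter.2 ⟨hq, hqx⟩)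

/-- An obstruction from above and one from below are compared; the reflection exchanges the
directions `0` and `1`. Together they empty the sites above, below and to the left of `v`. -/
theorem improvable_or_left_empty (hconn : ConnectedOn σ) (hvσ : v ∈ σ) (hxv : x₀ < v.1)
    (hs : InStrip x₀ x₁ σ) (hne : ∃ p ∈ σ, p.1 = x₀) :
    Improvable v x₀ x₁ σ ∨ Even (v.1 - x₀) ∧
      ∀ j, v + dir j ∈ σ → 0 < (dir j).1 := by
  rcases improvable_or_obstructed hconn hvσ hxv hs hne with h | ⟨hev, hT⟩
  · exact Or.inl h
  obtain ⟨p, hp, hpx⟩ := hne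
  have hs' : InStrip x₀ x₁ (Config.image mirror σ) := fun q hq => by
    have := hs _ (mem_image.1 hq)
    rwa [mirror_symm_apply] at this
  rcases improvable_or_obstructed (v := mirror v) (hconn.image mirror) (apply_mem_image.2 hvσ) hxv
    hs' ⟨mirror p, apply_mem_image.2 hp, hpx⟩ with ⟨τ, h1, h2, h3⟩ | ⟨-, hB⟩
  · refine Or.inl ⟨_, h1.of_image, fun q hq => ?_, ?_⟩
    · have := h2 _ (mem_image.1 hq)
      exact this
    · rwa [parityCount_image (x := x₀) (fun p => by rw [mirror_apply]),
        ← parityCount_image (e := mirror.symm) (x' := x₀) (σ := τ) (fun p => by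
          rw [mirror_symm_apply])] at h3
  · refine Or.inr ⟨hev, ?_⟩
    obtain ⟨vx, vy⟩ := v
    rw [mirror_apply, backEmpty_zero, backEmpty_one] at hB
    rw [backEmpty_zero, backEmpty_one] at hT
    have hcol : ∀ q ∈ σ, q.1 = x₀ →
        mirror q ∈ Config.image mirror σ ∧ (mirror q).1 = x₀ ∧ (mirror q).2 = x₀ - q.2 :=
      fun q hq hqx => ⟨apply_mem_image.2 hq, hqx, by rw [mirror_apply, hqx]⟩
    have key : ((vx, vy + 1) ∉ σ ∧ (vx - 1, vy) ∉ σ ∧ (vx - 1, vy - 1) ∉ σ) ∧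
        (vx, vy - 1) ∉ σ := by
      -- Obstructions of the same kind seen from above and below lie on different lines through `v`
      -- and give the four empty sites. Those of different kinds lie on one line and pin all agents
      -- of the border column to a single height, contradicting the two agents provided by the first
      -- kind.
      rcases hT with ⟨⟨a1, a2, a3⟩, ⟨p, hp, q, hq, hpq, hpx, hqx⟩, a5⟩ | ⟨⟨a1, a2, a3⟩, a4⟩
      · refine ⟨⟨a1, a2, a3⟩, ?_⟩
        rcases hB with ⟨⟨b1, -, -⟩, -⟩ | ⟨-, b4⟩
        · rwa [mem_image, mirror_symm_apply, show vx - (vx - vy + 1) = vy - 1 by ring] at b1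
        · exfalso
          have hval : ∀ r ∈ σ, r.1 = x₀ → r.2 = vy := fun r hr hrx => by
            have h1 := a5 r hr hrx
            have h2 := b4 _ (hcol r hr hrx).1 (hcol r hr hrx).2.1
            rw [(hcol r hr hrx).2.2] at h2
            omega
          exact hpq (Prod.ext (hpx.trans hqx.symm) ((hval p hp hpx).trans (hval q hq hqx).symm))
      · rcases hB with ⟨-, ⟨p, hp, q, hq, hpq, hpx, hqx⟩, b5⟩ | ⟨⟨-, -, b3⟩, -⟩
        · exfalso
          obtain ⟨p, rfl⟩ := mirror.surjective p
          obtain ⟨q, rfl⟩ := mirror.surjective q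
          rw [apply_mem_image] at hp hq
          have hval : ∀ r ∈ σ, r.1 = x₀ → r.2 = vy - (vx - x₀) := fun r hr hrx => by
            have h1 := a4 r hr hrx
            have h2 := b5 _ (hcol r hr hrx).1 (hcol r hr hrx).2.1
            rw [(hcol r hr hrx).2.2] at h2
            omega
          exact hpq (congrArg mirror (Prod.ext (hpx.trans hqx.symm)
            ((hval p hp hpx).trans (hval q hq hqx).symm)))
        · exact ⟨⟨by rwa [mem_image, mirror_symm_apply,
            show vx - (vx - vy - 1) = vy + 1 by ring] at b3, a1, a2⟩, a3⟩
    obtain ⟨⟨k1, k2, k3⟩, k4⟩ := key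
    intro j hj
    fin_cases j <;> simp [dir, ← sub_eq_add_neg] at hj ⊢
    exacts [k1 hj, k2 hj, k3 hj, k4 hj]

theorem improvable_or_right_empty (hconn : ConnectedOn σ) (hvσ : v ∈ σ) (hxv : v.1 < x₁)
    (hs : InStrip x₀ x₁ σ) (hne : ∃ p ∈ σ, p.1 = x₁) :
    (∃ τ, Reach v σ τ ∧ InStrip x₀ x₁ τ ∧ parityCount x₁ τ < parityCount x₁ σ) ∨
      Even (v.1 - x₁) ∧ ∀ j, v + dir j ∈ σ → (dir j).1 < 0 := by
  obtain ⟨p, hp, hpx⟩ := hne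
  have hs' : InStrip (-x₁) (-x₀) (Config.image halfTurn σ) := fun q hq => by
    have := hs _ (mem_image.1 hq)
    rw [halfTurn_symm_apply] at this
    omega
  have hpar : ∀ y : ℤ, Even (-y - -x₁) ↔ Even (y - x₁) := fun y => by
    rw [show -y - -x₁ = -(y - x₁) by ring, even_neg]
  rcases improvable_or_left_empty (v := halfTurn v) (x₀ := -x₁) (hconn.image halfTurn)
    (apply_mem_image.2 hvσ) (by rw [halfTurn_apply]; omega) hs'
    ⟨halfTurn p, apply_mem_image.2 hp, by rw [halfTurn_apply, hpx]⟩ with ⟨τ, h1, h2, h3⟩ | ⟨h1, h2⟩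
  · refine Or.inl ⟨_, h1.of_image, fun q hq => ?_, ?_⟩
    · have h4 : -x₁ ≤ -q.1 ∧ -q.1 ≤ -x₀ := h2 _ (mem_image.1 hq)
      omega
    · rwa [parityCount_image (x := x₁) (fun p => by rw [halfTurn_apply]; exact hpar _),
        ← parityCount_image (e := halfTurn.symm) (x' := x₁) (σ := τ) (fun p => by
          rw [halfTurn_symm_apply, ← hpar, neg_neg])] at h3
  · refine Or.inr ⟨(hpar _).1 h1, fun j hj => ?_⟩
    obtain ⟨j', hj'⟩ := exists_dir_neg j
    have := h2 j' (by
      rw [mem_image, halfTurn_symm_apply, halfTurn_apply, hj']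
      convert hj using 1
      ext <;> simp <;> ring)
    rw [hj', Prod.fst_neg] at this
    omega

/-- In a strip with agents on both border columns, the number of agents in the columns of a
suitable parity can be decreased. -/
theorem exists_parity_improvable (hx₀ : x₀ ≤ v.1) (hx₁ : v.1 ≤ x₁) (hlt : x₀ < x₁) :
    ∃ q, ∀ σ, ConnectedOn σ → v ∈ σ → InStrip x₀ x₁ σ → (∃ p ∈ σ, p.1 = x₀) →
      (∃ p ∈ σ, p.1 = x₁) →
      ∃ τ, Reach v σ τ ∧ InStrip x₀ x₁ τ ∧ parityCount q τ < parityCount q σ := by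
  by_cases h0 : Even (v.1 - x₀)
  swap
  · have hne : x₀ ≠ v.1 := fun h => h0 (by simp [h])
    refine ⟨x₀, fun σ hc hv hs hl _ => ?_⟩
    rcases improvable_or_left_empty hc hv (lt_of_le_of_ne hx₀ hne) hs hl with h | h
    exacts [h, absurd h.1 h0]
  by_cases h1 : Even (v.1 - x₁)
  swap
  · have hne : v.1 ≠ x₁ := fun h => h1 (by simp [h])
    refine ⟨x₁, fun σ hc hv hs _ hr => ?_⟩
    rcases improvable_or_right_empty hc hv (lt_of_le_of_ne hx₁ hne) hs hr with h | h
    exacts [h, absurd h.1 h1]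
  refine ⟨x₀, fun σ hc hv hs hl hr => ?_⟩
  have hcount : ∀ σ, parityCount x₁ σ = parityCount x₀ σ := fun σ => by
    unfold parityCount
    congr 1
    refine Finset.filter_congr fun p _ => ?_
    rw [show p.1 - x₁ = p.1 - x₀ + ((v.1 - x₁) - (v.1 - x₀)) by ring, Int.even_add]
    have hd := h1.sub h0
    tauto
  -- A single neighbour of `v` gives the contradiction: an obstructed left border puts it strictly
  -- to the right, an obstructed right border strictly to the left. If `v` is in a border column,
  -- the strip itself excludes one side.
  obtain ⟨j, hj⟩ : ∃ j, v + dir j ∈ σ := by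
    obtain ⟨p, hp, hpx⟩ := hl
    obtain ⟨q, hq, hqx⟩ := hr
    by_cases hpv : v = p
    · exact hc.exists_nbr hv hq fun h => by rw [h] at hpv; rw [← hpv] at hpx; omega
    · exact hc.exists_nbr hv hp hpv
  have hleft : Improvable v x₀ x₁ σ ∨ 0 ≤ (dir j).1 := by
    rcases hx₀.eq_or_lt with h | h
    · have := (hs _ hj).1
      rw [Prod.fst_add] at this
      exact Or.inr (by omega)
    · exact (improvable_or_left_empty hc hv h hs hl).imp id fun h => (h.2 j hj).le
  have hright : Improvable v x₀ x₁ σ ∨ (v.1 < x₁ → (dir j).1 < 0) ∧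
      (v.1 = x₁ → (dir j).1 ≤ 0) := by
    rcases hx₁.eq_or_lt with h | h
    · have := (hs _ hj).2
      rw [Prod.fst_add] at this
      exact Or.inr ⟨by omega, by omega⟩
    · rcases improvable_or_right_empty hc hv h hs hr with ⟨τ, h1, h2, h3⟩ | h'
      · exact Or.inl ⟨τ, h1, h2, by rwa [← hcount, ← hcount]⟩
      · exact Or.inr ⟨fun _ => h'.2 j hj, by omega⟩
  by_contra hno
  have hL := hleft.resolve_left hno
  have hR := hright.resolve_left hno
  rcases hx₁.eq_or_lt with h | h
  · rcases improvable_or_left_empty hc hv (by omega) hs hl with h' | h'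
    · exact hno h'
    · have := h'.2 j hj
      have := hR.2 h
      omega
  · have := hR.1 h
    omega

/-- All agents can be brought into the column of the immobile agent. -/
theorem exists_reach_column (m : ℕ) : ∀ (x₀ x₁ : ℤ) (σ : Config), x₁ - x₀ ≤ m → ConnectedOn σ →
    v ∈ σ → InStrip x₀ x₁ σ → ∃ τ, Reach v σ τ ∧ ∀ p ∈ τ, p.1 = v.1 := by
  induction m with
  | zero =>
    intro x₀ x₁ σ hm hc hv hs
    refine ⟨σ, .refl, fun p hp => ?_⟩
    have := hs p hp
    have := hs v hv
    push_cast at hm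
    omega
  | succ m ih =>
    intro x₀ x₁ σ hm hc hv hs
    push_cast at hm
    have hvs := hs v hv
    rcases (hvs.1.trans hvs.2).eq_or_lt with heq | hlt
    · refine ih x₀ x₁ σ (by omega) hc hv hs
    -- The parity `q` depends on the strip only, so successive improvements lower the same count
    -- until one border column is empty.
    obtain ⟨q, hq⟩ := exists_parity_improvable hvs.1 hvs.2 hlt
    induction hN : parityCount q σ using Nat.strong_induction_on generalizing σ with
    | _ N IH =>
      by_cases hl : ∃ p ∈ σ, p.1 = x₀
      · by_cases hr : ∃ p ∈ σ, p.1 = x₁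
        · obtain ⟨τ, h1, h2, h3⟩ := hq σ hc hv hs hl hr
          obtain ⟨ρ, h4, h5⟩ := IH _ (hN ▸ h3) τ (h1.connectedOn hc) (h1.mem hv) h2 rfl
          exact ⟨ρ, h1.trans h4, h5⟩
        · push Not at hr
          refine ih x₀ (x₁ - 1) σ (by omega) hc hv fun p hp => ?_
          have := hs p hp
          have := hr p hp
          omega
      · push Not at hl
        refine ih (x₀ + 1) x₁ σ (by omega) hc hv fun p hp => ?_
        have := hs p hp
        have := hl p hp
        omega

end Compression

/-! ### Vertical segments as canonical configurations. -/

namespace Compression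
variable {v : Site} {σ τ : Config} {n : ℕ}

/-- The vertical segment of sites from height `p` to height `q` in column `x`. -/
noncomputable def columnSegment (x p q : ℤ) : Config := (Finset.Icc p q).image fun y => (x, y)

theorem mem_columnSegment {x p q : ℤ} {z : Site} :
    z ∈ columnSegment x p q ↔ z.1 = x ∧ p ≤ z.2 ∧ z.2 ≤ q := by
  obtain ⟨a, b⟩ := z
  simp only [columnSegment, Finset.mem_image, Finset.mem_Icc, Prod.mk.injEq]
  constructor
  · rintro ⟨y, h, rfl, rfl⟩
    exact ⟨rfl, h⟩
  · rintro ⟨rfl, h⟩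
    exact ⟨b, h, rfl, rfl⟩

theorem card_columnSegment (x p q : ℤ) : (columnSegment x p q).card = (q + 1 - p).toNat := by
  rw [columnSegment, Finset.card_image_of_injective _ (fun a b h => congrArg Prod.snd h),
    Int.card_Icc]

theorem exists_eq_columnSegment (hc : ConnectedOn σ) (hv : v ∈ σ) (hcol : ∀ p ∈ σ, p.1 = v.1) :
    ∃ p q, p ≤ v.2 ∧ v.2 ≤ q ∧ σ = columnSegment v.1 p q := by
  obtain ⟨a, ha, hmin⟩ := σ.exists_min_image (fun p => p.2) ⟨v, hv⟩
  obtain ⟨b, hb, hmax⟩ := σ.exists_max_image (fun p => p.2) ⟨v, hv⟩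
  refine ⟨a.2, b.2, hmin v hv, hmax v hv, ?_⟩
  ext z
  rw [mem_columnSegment]
  refine ⟨fun hz => ⟨hcol z hz, hmin z hz, hmax z hz⟩, fun ⟨h1, h2, h3⟩ => ?_⟩
  by_contra hz
  have hne : ∀ w ∈ σ, w.2 ≠ z.2 := fun w hw h =>
    hz (by rw [show z = w from Prod.ext (h1.trans (hcol w hw).symm) h.symm]; exact hw)
  -- Within a column, adjacent agents differ by one in height, so an unoccupied height would
  -- separate those below it from those above.
  have := (connectedOn_iff.1 hc).2 (fun w => w.2 < z.2) (fun p hp q hq hpq hlt => by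
    have e1 := hcol p hp
    have e2 := hcol q hq
    have e3 := hne q hq
    rw [adj_iff] at hpq
    omega) a ha b hb (lt_of_le_of_ne h2 (hne a ha))
  omega

/-- The bottom agent steps into the column on the right, climbs along the segment, and returns to
the column on top. -/
theorem reach_columnSegment_shift {p q : ℤ} (hp : p < v.2) (hq : v.2 ≤ q) :
    Reach v (columnSegment v.1 p q) (columnSegment v.1 (p + 1) (q + 1)) := by
  obtain ⟨x, y₀⟩ := v
  dsimp only at hp hq ⊢
  have h1 : Step (x, y₀) (columnSegment x p q)
      (insert (x + 1, p + 1) (columnSegment x (p + 1) q)) := by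
    refine ⟨(x, p), (x + 1, p + 1), fun h => ?_, (isRing_upRight x p).validMove_iff.2 ?_, ?_⟩
    · simp only [Prod.mk.injEq] at h
      omega
    · have ha : (x, p + 1) ∈ columnSegment x p q := mem_columnSegment.2 ⟨rfl, by simp, by omega⟩
      refine ⟨mem_columnSegment.2 ⟨rfl, le_rfl, by omega⟩, ?_, Or.inl ⟨Or.inl ha, ?_, ?_⟩, ?_⟩ <;>
        simp [mem_columnSegment, Chained]
    · ext ⟨z₁, z₂⟩
      simp only [mem_move, Finset.mem_insert, mem_columnSegment, Prod.mk.injEq, ne_eq]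
      omega
  have h2 : ∀ m : ℕ, p + 1 + m ≤ q + 1 → Reach (x, y₀) (columnSegment x p q)
      (insert (x + 1, p + 1 + m) (columnSegment x (p + 1) q)) := by
    intro m
    induction m with
    | zero => exact fun _ => .single (by simpa using h1)
    | succ m ih =>
      intro hm
      push_cast at hm
      refine (ih (by omega)).tail ⟨(x + 1, p + 1 + m), (x + 1, p + 1 + m + 1), fun h => ?_,
        (isRing_up (x + 1) (p + 1 + m)).validMove_iff.2 ?_, ?_⟩
      · simp only [Prod.mk.injEq] at h
        omega
      · have ha : (x + 1 - 1, p + 1 + (m : ℤ)) ∈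
            insert (x + 1, p + 1 + (m : ℤ)) (columnSegment x (p + 1) q) := by
          rw [Finset.mem_insert, mem_columnSegment]
          exact Or.inr ⟨by simp, by simp, by dsimp only; omega⟩
        refine ⟨Finset.mem_insert_self _ _, ?_, Or.inl ⟨Or.inl ha, ?_, ?_⟩, ?_⟩
        · simp [mem_columnSegment]
        · exact ⟨fun _ => Or.inl ha, by simp [mem_columnSegment], by simp [mem_columnSegment]; omega⟩
        · exact ⟨fun _ => Or.inl ha, by simp [mem_columnSegment], by simp [mem_columnSegment]; omega⟩
        · simp [mem_columnSegment]
      · ext ⟨z₁, z₂⟩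
        simp only [mem_move, Finset.mem_insert, mem_columnSegment, Prod.mk.injEq, ne_eq]
        push_cast
        omega
  refine (h2 (q - p).toNat (by omega)).tail ⟨(x + 1, q + 1), (x, q + 1), fun h => ?_, ?_, ?_⟩
  · simp only [Prod.mk.injEq] at h
    omega
  · rw [show p + 1 + ((q - p).toNat : ℤ) = q + 1 by omega]
    have hr := isRing_left (x - 1) (q + 1)
    rw [show x - 1 + 2 = x + 1 by ring, show x - 1 + 1 = x by ring, show x - 1 + 3 = x + 2 by ring,
      show q + 1 - 1 = q by ring] at hr
    have ha : (x, q) ∈ insert (x + 1, q + 1) (columnSegment x (p + 1) q) := by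
      rw [Finset.mem_insert, mem_columnSegment]
      exact Or.inr ⟨rfl, by dsimp only; omega, le_rfl⟩
    refine hr.validMove_iff.2
      ⟨Finset.mem_insert_self _ _, ?_, Or.inl ⟨Or.inl ha, ?_, ?_⟩, ?_⟩
    · simp [mem_columnSegment]
    · simp [mem_columnSegment, Chained]
    · simp [mem_columnSegment, Chained]; omega
    · simp [mem_columnSegment]
  · ext ⟨z₁, z₂⟩
    simp only [mem_move, Finset.mem_insert, mem_columnSegment, Prod.mk.injEq, ne_eq]
    omega

theorem reach_columnSegment_bottom (m : ℕ) : ∀ p q : ℤ, v.2 - p = m → v.2 ≤ q →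
    Reach v (columnSegment v.1 p q) (columnSegment v.1 v.2 (q + m)) := by
  induction m with
  | zero =>
    intro p q hp _
    rw [show p = v.2 by push_cast at hp; omega]
    simpa using Relation.ReflTransGen.refl
  | succ m ih =>
    intro p q hp hq
    push_cast at hp
    have := ih (p + 1) (q + 1) (by omega) (by omega)
    rw [show q + ((m + 1 : ℕ) : ℤ) = q + 1 + m by push_cast; ring]
    exact (reach_columnSegment_shift (by omega) hq).trans this

/-- Every connected configuration can be brought into the vertical segment with `v` at its lower
end. -/
theorem reach_columnSegment (hc : ConnectedOn σ) (hv : v ∈ σ) :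
    Reach v σ (columnSegment v.1 v.2 (v.2 + σ.card - 1)) := by
  obtain ⟨a, ha, hmin⟩ := σ.exists_min_image (fun p => p.1) ⟨v, hv⟩
  obtain ⟨b, hb, hmax⟩ := σ.exists_max_image (fun p => p.1) ⟨v, hv⟩
  obtain ⟨τ, hτ, hcol⟩ := exists_reach_column (v := v) (b.1 - a.1).toNat a.1 b.1 σ (by omega) hc hv
    fun p hp => ⟨hmin p hp, hmax p hp⟩
  obtain ⟨p, q, hp, hq, rfl⟩ := exists_eq_columnSegment (hτ.connectedOn hc) (hτ.mem hv) hcol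
  have hcard := hτ.card_eq
  rw [card_columnSegment] at hcard
  have := reach_columnSegment_bottom (v := v) (v.2 - p).toNat p q (by omega) hq
  rw [show v.2 + (σ.card : ℤ) - 1 = q + (v.2 - p).toNat by omega]
  exact hτ.trans this

theorem reach_of_simplyConnected (hvσ : v ∈ σ) (hvτ : v ∈ τ) (hcard : σ.card = τ.card)
    (hσ : ConnectedOn σ) (hτ : SimplyConnected τ) : Reach v σ τ := by
  have h := reach_columnSegment hσ hvσ
  rw [hcard] at h
  exact h.trans ((reach_columnSegment hτ.1 hvτ).reverse hvτ hτ.2)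

/-! ### The Markov chain. -/

theorem acceptProb_nonneg {lam : ℝ} (hlam : 0 < lam) (l l' : Site) :
    0 ≤ acceptProb lam v σ l l' := by
  unfold acceptProb
  split_ifs
  · exact le_min zero_le_one (zpow_pos hlam _).le
  · exact le_rfl

theorem acceptProb_le_one {lam : ℝ} (l l' : Site) : acceptProb lam v σ l l' ≤ 1 := by
  unfold acceptProb
  split_ifs
  · exact min_le_left _ _
  · exact zero_le_one

theorem transition_summand_nonneg {lam : ℝ} (hlam : 0 < lam) (l l' : Site) (P Q : Prop)
    [Decidable P] [Decidable Q] :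
    0 ≤ (1 / (6 * (σ.card : ℝ))) * (acceptProb lam v σ l l' * (if P then 1 else 0) +
      (1 - acceptProb lam v σ l l') * (if Q then 1 else 0)) := by
  have h1 := acceptProb_nonneg (v := v) (σ := σ) hlam l l'
  have h2 := sub_nonneg.2 (acceptProb_le_one (v := v) (σ := σ) (lam := lam) l l')
  have h3 : (0 : ℝ) ≤ if P then 1 else 0 := by split_ifs <;> norm_num
  have h4 : (0 : ℝ) ≤ if Q then 1 else 0 := by split_ifs <;> norm_num
  positivity

theorem transitionProb_nonneg {lam : ℝ} (hlam : 0 < lam) : 0 ≤ transitionProb lam v σ τ :=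
  Finset.sum_nonneg fun _ _ => Finset.sum_nonneg fun _ _ => transition_summand_nonneg hlam _ _ _ _

theorem Step.transitionProb_pos {lam : ℝ} (hlam : 0 < lam) (h : Step v σ τ) :
    0 < transitionProb lam v σ τ := by
  obtain ⟨l, l', hl, h, rfl⟩ := h
  obtain ⟨d, rfl⟩ := h.2.2.1
  refine Finset.sum_pos' (fun _ _ => Finset.sum_nonneg fun _ _ =>
    transition_summand_nonneg hlam _ _ _ _) ⟨l, h.1, Finset.sum_pos' (fun _ _ =>
      transition_summand_nonneg hlam _ _ _ _) ⟨d, Finset.mem_univ _, ?_⟩⟩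
  have hcard : (0 : ℝ) < σ.card := by exact_mod_cast Finset.card_pos.2 ⟨l, h.1⟩
  have hacc : 0 < acceptProb lam v σ l (l + dir d) := by
    unfold acceptProb
    rw [if_pos ⟨hl, h⟩]
    exact lt_min one_pos (zpow_pos hlam _)
  have h2 := sub_nonneg.2 (acceptProb_le_one (v := v) (σ := σ) (lam := lam) l (l + dir d))
  rw [if_pos rfl, mul_one]
  split_ifs <;> positivity

theorem Step.state (h : Step v σ τ) (hσ : v ∈ σ ∧ σ.card = n ∧ SimplyConnected σ) :
    v ∈ τ ∧ τ.card = n ∧ SimplyConnected τ :=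
  ⟨h.mem hσ.1, h.card_eq.trans hσ.2.1, h.connectedOn hσ.2.2.1, h.holeFree hσ.2.2.2⟩

/-- Each choice of agent and direction contributes two point masses of total weight `1 / (6 * n)`. A
mass of nonzero weight sits at a state because `Step` preserves the state conditions; no probability
escapes. -/
theorem hasSum_transitionMatrix (lam : ℝ) (σ : State v n) :
    HasSum (fun τ : State v n => transitionMatrix lam v n σ τ) 1 := by
  have hcard : (σ.1.card : ℝ) ≠ 0 := by
    exact_mod_cast (Finset.card_pos.2 ⟨v, σ.2.1⟩).ne'
  have hsingle : ∀ (c : ℝ) (ρ : Config), (c ≠ 0 → v ∈ ρ ∧ ρ.card = n ∧ SimplyConnected ρ) →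
      HasSum (fun τ : State v n => c * (if τ.1 = ρ then 1 else 0)) c := by
    intro c ρ hρ
    by_cases hc : c = 0
    · simp [hc]
    · have := hasSum_single (f := fun τ : State v n => c * (if τ.1 = ρ then 1 else 0)) ⟨ρ, hρ hc⟩
        (fun τ hτ => by
          rw [if_neg (fun h => hτ (Subtype.ext h)), mul_zero])
      simpa using this
  have hsum := hasSum_sum (s := σ.1) fun l (_ : l ∈ σ.1) =>
    hasSum_sum (s := (Finset.univ : Finset (Fin 6))) fun d _ =>
      ((hsingle (acceptProb lam v σ.1 l (l + dir d)) (move σ.1 l (l + dir d)) (fun h => by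
          have hstep : Step v σ.1 (move σ.1 l (l + dir d)) := by
            by_contra hn
            refine h (if_neg fun hv => hn ⟨l, _, hv.1, hv.2, rfl⟩)
          exact hstep.state σ.2)).add
        (hsingle (1 - acceptProb lam v σ.1 l (l + dir d)) σ.1 fun _ => σ.2)).mul_left
        (1 / (6 * (σ.1.card : ℝ)))
  have htot : ∑ l ∈ σ.1, ∑ d : Fin 6, 1 / (6 * (σ.1.card : ℝ)) *
      (acceptProb lam v σ.1 l (l + dir d) + (1 - acceptProb lam v σ.1 l (l + dir d))) = 1 := by
    simp only [add_sub_cancel, mul_one, Finset.sum_const, Finset.card_univ, Fintype.card_fin,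
      nsmul_eq_mul]
    field_simp
    norm_num
  rw [htot] at hsum
  exact hsum

theorem transitionMatrix_isIrreducible {lam : ℝ} (hlam : 0 < lam) :
    (transitionMatrix lam v n).IsIrreducible := by
  refine ⟨fun σ τ => transitionProb_nonneg hlam, ?_⟩
  let _ : Quiver (State v n) := Matrix.toQuiver (transitionMatrix lam v n)
  have hpath : ∀ (σ : State v n) (τ : Config), Reach v σ.1 τ →
      ∃ h : v ∈ τ ∧ τ.card = n ∧ SimplyConnected τ,
        Nonempty (Quiver.Path σ (⟨τ, h⟩ : State v n)) := by
    intro σ τ h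
    induction h with
    | refl => exact ⟨σ.2, ⟨Quiver.Path.nil⟩⟩
    | tail _ hstep ih =>
      obtain ⟨h, ⟨p⟩⟩ := ih
      exact ⟨hstep.state h, ⟨p.cons ⟨hstep.transitionProb_pos hlam⟩⟩⟩
  intro σ τ
  -- Irreducibility asks for a path of positive length even when `σ = τ`, so one edge is taken
  -- first; it exists because the row sums to one.
  obtain ⟨ρ, hρ⟩ : ∃ ρ, 0 < transitionMatrix lam v n σ ρ := by
    by_contra! hn
    have h0 : (fun ρ => transitionMatrix lam v n σ ρ) = fun _ => 0 :=
      funext fun ρ => le_antisymm (hn ρ) (transitionProb_nonneg hlam)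
    have := hasSum_transitionMatrix lam σ
    rw [h0] at this
    exact zero_ne_one (hasSum_zero.unique this)
  obtain ⟨p⟩ : Nonempty (Quiver.Path ρ τ) := (hpath ρ τ.1 (reach_of_simplyConnected ρ.2.1 τ.2.1
    (ρ.2.2.1.trans τ.2.2.1.symm) ρ.2.2.2.1 τ.2.2.2)).2
  let e : σ ⟶ ρ := ⟨hρ⟩
  exact ⟨e.toPath.comp p, by
    rw [Quiver.Path.length_comp, Quiver.Path.length_toPath]; omega⟩

end Compression

theorem mainTheorem8 (v : Compression.Site) (n : ℕ) :
    (∀ σ τ : Compression.Config, v ∈ σ → v ∈ τ → σ.card = n → τ.card = n →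
      Compression.ConnectedOn σ → Compression.SimplyConnected τ →
        Relation.ReflTransGen (Compression.Step v) σ τ) ∧
    (∀ lam : ℝ, 0 < lam →
      (∀ σ : Compression.State v n,
        HasSum (fun τ : Compression.State v n =>
          Compression.transitionMatrix lam v n σ τ) 1) ∧
      (Compression.transitionMatrix lam v n).IsIrreducible) :=
  ⟨fun _ _ hvσ hvτ h1 h2 hσ hτ =>
      Compression.reach_of_simplyConnected hvσ hvτ (h1.trans h2.symm) hσ hτ,
    fun lam hlam => ⟨Compression.hasSum_transitionMatrix lam,
      Compression.transitionMatrix_isIrreducible hlam⟩⟩
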